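/- Let $\kappa>1$, let $\{B(x)\}_{x\in\mathbb R}$ be a two-sided standard one-dimensional Brownian motion with $B(0)=0$, let $W(x)=B(x)-\frac{\kappa}{2}x$, and set $\Sigma(r)=\int_0^r e^{-W(y)}\,dy$ for $r>0$. For every $\delta>0$ there exist constants $c_1,c_2>0$, depending only on $\delta$ and $\kappa$, such that for all $r$ large enough $$\mathbb P\left(\left|\log\Sigma(r)-\frac{\kappa}{2}r\right|>\delta r\right)\le c_1e^{-c_2r}.$$ Furthermore, let $d>2$ and let $\{R(t)\}_{t\ge0}$ be a Bessel process of dimension $d$ started at $2$; that is, $R$ is a nonnegative continuous adapted process with $R(0)=2$ and $$R^2(t)=4+2\int_0^tR(s)\,d\gamma(s)+d\,t,\qquad t\ge0,$$ for some Brownian motion $\gamma$ relative to the underlying filtration, the integral being an Itô integral. Then almost surely $\int_0^r R^{-2}(s)\,ds<\infty$ for all $r\ge 0$, and for every $\delta>0$ there exist constants $c_3,c_4>0$, depending only on $\delta$ and $d$, such that for all $r$ large enough $$\mathbb P\left(\left|\frac1{\log r}\int_0^r\frac{ds}{R^2(s)}-\frac1{d-2}\right|>\delta\right)\le\frac{c_3}{r^{c_4}}.$$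 -/

import Mathlib

open MeasureTheory ProbabilityTheory Filter
open scoped NNReal

noncomputable section

namespace BrownianPotential

/-- A two-sided Brownian motion `(B x)`, `x ∈ ℝ`, started at zero: the processes `(B t)`, `t ≥ 0`,
and `(B (-t))`, `t ≥ 0`, are independent standard Brownian motions. -/
structure IsTwoSidedBrownian {Ω : Type*} [MeasurableSpace Ω] (B : ℝ → Ω → ℝ) (P : Measure Ω) :
    Prop where
  forward : IsBrownianReal (fun (t : ℝ≥0) ω => B (t : ℝ) ω) P
  backward : IsBrownianReal (fun (t : ℝ≥0) ω => B (-(t : ℝ)) ω) P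
  indep : IndepFun (fun ω (t : ℝ≥0) => B (t : ℝ) ω) (fun ω (t : ℝ≥0) => B (-(t : ℝ)) ω) P

/-- The random potential `W(x) = B(x) - (κ / 2) x`. -/
def potential {Ω : Type*} (κ : ℝ) (B : ℝ → Ω → ℝ) (x : ℝ) (ω : Ω) : ℝ :=
  B x ω - κ / 2 * x

/-- The exponential functional `Σ(r) = ∫_0^r exp (-W(y)) dy` of the potential. -/
def expFunctional {Ω : Type*} (κ : ℝ) (B : ℝ → Ω → ℝ) (r : ℝ) (ω : Ω) : ℝ :=
  ∫ y in (0 : ℝ)..r, Real.exp (-potential κ B y ω)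

/-- `γ` is a standard Brownian motion relative to the filtration `𝓕`: it is a Brownian motion
started at zero, it is adapted to `𝓕`, and its increments after time `s` are independent of
`𝓕 s`. -/
structure IsBrownianWrt {Ω : Type*} [mΩ : MeasurableSpace Ω] (γ : ℝ≥0 → Ω → ℝ)
    (𝓕 : Filtration ℝ≥0 mΩ) (P : Measure Ω) : Prop extends IsBrownianReal γ P where
  adapted : StronglyAdapted 𝓕 γ
  indep : ∀ s t : ℝ≥0, s ≤ t →
    Indep (𝓕 s) (MeasurableSpace.comap (fun ω => γ t ω - γ s ω) inferInstance) P

/-- The left-endpoint sum `∑_i H(t_i) (γ(t_{i+1} ∧ t) - γ(t_i))` over the grid points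
`t_i = i / 2 ^ n` that are smaller than `t`. -/
def itoSum {Ω : Type*} (H γ : ℝ≥0 → Ω → ℝ) (n : ℕ) (t : ℝ≥0) (ω : Ω) : ℝ :=
  ∑ i ∈ Finset.range ⌈t * 2 ^ n⌉₊,
    H ((i : ℝ≥0) / 2 ^ n) ω *
      (γ (min (((i : ℝ≥0) + 1) / 2 ^ n) t) ω - γ ((i : ℝ≥0) / 2 ^ n) ω)

/-- `I t = ∫_0^t H dγ` for every `t ≥ 0`, in the sense of Itô, for a process `H` with continuous
paths which is adapted to a filtration relative to which `γ` is a Brownian motion: the limit in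
probability of the left-endpoint sums. -/
def IsItoIntegral {Ω : Type*} [MeasurableSpace Ω] (H γ I : ℝ≥0 → Ω → ℝ) (P : Measure Ω) : Prop :=
  ∀ t : ℝ≥0, TendstoInMeasure P (fun n ω => itoSum H γ n t ω) atTop (I t)

/-- `R` is a Bessel process of dimension `d` started at `x`: it is nonnegative and continuous,
`R(0) = x`, and `R ^ 2` solves the stochastic differential equation
`d(R ^ 2)(t) = 2 R(t) dγ(t) + d dt`, that is, `R(t) ^ 2 - x ^ 2 - d t = ∫_0^t 2 R dγ`, for some
filtration to which `R` is adapted and some Brownian motion `γ` relative to that filtration. -/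
def IsBessel {Ω : Type*} [mΩ : MeasurableSpace Ω] (d x : ℝ) (R : ℝ≥0 → Ω → ℝ) (P : Measure Ω) :
    Prop :=
  ∃ (𝓕 : Filtration ℝ≥0 mΩ) (γ : ℝ≥0 → Ω → ℝ),
    IsBrownianWrt γ 𝓕 P ∧
    StronglyAdapted 𝓕 R ∧
    (∀ᵐ ω ∂P, Continuous fun t => R t ω) ∧
    (∀ᵐ ω ∂P, ∀ t, 0 ≤ R t ω) ∧
    (∀ᵐ ω ∂P, R 0 ω = x) ∧
    IsItoIntegral (fun t ω => 2 * R t ω) γ (fun t ω => R t ω ^ 2 - x ^ 2 - d * (t : ℝ)) P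

end BrownianPotential

end

/-!
# Exponential functionals of Brownian motion and clocks of Bessel processes

*Exponential functional.* A union bound over integer times controls the Brownian path at these
times and the exponential functionals of its increments over unit intervals, which gives the upper
bound for `Σ(r)`; the lower bound follows from an exponential moment of the path on `[r - 1, r]`.
Only Gaussian exponential moments and Markov's inequality are used.

*Bessel processes.* Write `X = R²` and `a = d - 2`. The generator of `X` is `2 z ∂² + d ∂`, so for
`ε > 0` and real `p` the process `(X + ε)ᵖ exp (-∫ besselRate d ε p (X s) ds)` is formally a
positive local martingale. What is proved is that its expectation is at most its initial value
(`IsBessel.exists_version_lintegral_le`). No Itô formula is needed. The Euler scheme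
of `X` along a dyadic grid has exactly Gaussian conditional increments, so a second-order Taylor
expansion of a test function which equals `(z + ε)ᵖ` on a large interval shows that a suitably
compensated and killed functional of the scheme is a supermartingale
(`IsTestFunction.lintegral_pathWeight_le`). The Itô integral, being a limit of left-endpoint sums,
makes the scheme converge to `X` almost everywhere on `[0, t] × Ω` along a subsequence
(`exists_subseq_tendsto_itoSum`), and Fatou's lemma, applied along the subsequence and then as the
killing level grows, gives the inequality.

Let `A` be the clock `∫₀ᵗ ds / X s`, taken up to the time `t` at which the process is
evaluated. Three choices of `p` give the tail estimates.
* `p = 1`, `ε = r`: the endpoint `X r` exceeds `r ^ (1 + η)` with polynomially small probability.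
* `p = -θ`, `ε → 0`: `E[X r ^ (-θ) exp (θ (a - 2 θ) A)] ≤ 4 ^ (-θ)`. Hence the clock, in
  which `1 / 0` is read as `∞`, is finite, and together with the previous point it exceeds
  `(1 / a + δ) log r` with polynomially small probability.
* `p = θ`, `ε → 0`: `E[X s ^ θ exp (-θ (a + 2 θ) A)] ≤ 4 ^ θ` for `s ≤ r`. If the clock at
  time `r` is below `(1 / a - δ) log r` then `X` exceeds `T = r ^ (1 - η)` for most of the
  time, because time spent below `T` adds at least `1 / T` per unit to the clock.
  So `∫₀ʳ X ^ θ ds` is large, while on this event its expectation is small by the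
  displayed inequality.
-/

/-! ### Continuous modifications and Gaussian exponential moments -/

namespace BrownianPotential

/-- A process with almost surely continuous paths and a.e.-measurable marginals agrees, outside a
single null set, with a process all of whose paths are continuous and all of whose marginals are
measurable. -/
theorem exists_continuous_modification {Ω : Type*} [MeasurableSpace Ω] {P : Measure Ω}
    {X : ℝ≥0 → Ω → ℝ} (hm : ∀ t, AEMeasurable (X t) P)
    (hc : ∀ᵐ ω ∂P, Continuous fun t => X t ω) :
    ∃ Y : ℝ≥0 → Ω → ℝ, (∀ t, Measurable (Y t)) ∧ (∀ ω, Continuous fun t => Y t ω) ∧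
      ∀ᵐ ω ∂P, ∀ t, Y t ω = X t ω := by
  set D := TopologicalSpace.denseSeq ℝ≥0 with hD
  have hgood : ∀ᵐ ω ∂P, (Continuous fun t => X t ω) ∧ ∀ n, X (D n) ω = (hm (D n)).mk _ ω :=
    hc.and (ae_all_iff.2 fun n => (hm (D n)).ae_eq_mk)
  obtain ⟨N, hN, hNm, hNP⟩ := hgood.exists_measurable_mem
  have hYD : ∀ n, Measurable (N.indicator (X (D n))) := by
    intro n
    have : N.indicator (X (D n)) = N.indicator ((hm (D n)).mk _) := by
      ext ω
      by_cases h : ω ∈ N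
      · simp [h, (hNP ω h).2 n]
      · simp [h]
    rw [this]
    exact (hm (D n)).measurable_mk.indicator hNm
  have hcont : ∀ ω, Continuous fun t => N.indicator (X t) ω := by
    intro ω
    by_cases h : ω ∈ N
    · simpa [h] using (hNP ω h).1
    · simpa [h] using continuous_const
  refine ⟨fun t => N.indicator (X t), fun t => ?_, hcont, ?_⟩
  · have ht : t ∈ closure (Set.range D) := TopologicalSpace.denseRange_denseSeq ℝ≥0 t
    obtain ⟨x, hx, hxt⟩ := mem_closure_iff_seq_limit.1 ht
    refine measurable_of_tendsto_metrizable (f := fun n => N.indicator (X (x n))) (fun n => ?_) ?_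
    · obtain ⟨k, hk⟩ := hx n
      rw [← hk]
      exact hYD k
    · exact tendsto_pi_nhds.2 fun ω => ((hcont ω).tendsto t).comp hxt
  · filter_upwards [hN] with ω hω t
    simp [hω]

/-- The exponential moments of a centred Gaussian variable. -/
theorem lintegral_exp_mul_of_hasLaw_gaussianReal {Ω : Type*} [MeasurableSpace Ω] {P : Measure Ω}
    {X : Ω → ℝ} {v : ℝ≥0} (hX : HasLaw X (gaussianReal 0 v) P) (l : ℝ) :
    ∫⁻ ω, ENNReal.ofReal (Real.exp (l * X ω)) ∂P = ENNReal.ofReal (Real.exp (v * l ^ 2 / 2)) := by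
  rw [hX.lintegral_comp (f := fun x => ENNReal.ofReal (Real.exp (l * x))) (by fun_prop),
    ← ofReal_integral_eq_lintegral_ofReal (integrable_exp_mul_gaussianReal l)
      (ae_of_all _ fun x => (Real.exp_pos _).le)]
  have h := mgf_gaussianReal (p := gaussianReal 0 v) (X := id) (μ := 0) (v := v) (by simp) l
  simp only [mgf, id, zero_mul, zero_add] at h
  rw [h]

/-- Markov's inequality in the form used throughout: a nonnegative function with integral at most
`A` is at least `b` on a set of measure at most `A / b`. -/
theorem measure_le_ofReal_div {Ω : Type*} [MeasurableSpace Ω] {P : Measure Ω} {f : Ω → ℝ}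
    (hf : AEMeasurable f P) {A b : ℝ} (hb : 0 < b)
    (h : ∫⁻ ω, ENNReal.ofReal (f ω) ∂P ≤ ENNReal.ofReal A) {S : Set Ω}
    (hS : ∀ᵐ ω ∂P, ω ∈ S → b ≤ f ω) : P S ≤ ENNReal.ofReal (A / b) := by
  have h1 : P S ≤ P {ω | ENNReal.ofReal b ≤ ENNReal.ofReal (f ω)} := by
    refine measure_mono_ae ?_
    filter_upwards [hS] with ω hω hωS using ENNReal.ofReal_le_ofReal (hω hωS)
  refine h1.trans ((meas_ge_le_lintegral_div hf.ennreal_ofReal (by simpa using hb)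
    ENNReal.ofReal_ne_top).trans ?_)
  rw [ENNReal.ofReal_div_of_pos hb]
  gcongr

theorem exp_half_le_two : Real.exp (1 / 2) ≤ 2 := by
  have h := Real.exp_one_lt_d9
  have h' : Real.exp (1 / 2) * Real.exp (1 / 2) = Real.exp 1 := by
    rw [← Real.exp_add]; norm_num
  nlinarith [Real.exp_pos (1 / 2)]

end BrownianPotential

/-! ### The exponential functional of drifted Brownian motion -/

namespace BrownianPotential

/-- An upper bound for the exponential functional in terms of the values of the path at integer
times and of the exponential functionals of its increments over unit intervals. -/
theorem integral_exp_neg_le_of_unit_bounds {w : ℝ → ℝ} (hw : Continuous w) {κ ε r : ℝ}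
    (hκ : 0 ≤ κ) (hr : 0 ≤ r) (h1 : ∀ k : ℕ, k ≤ ⌊r⌋₊ → -w k ≤ ε * r)
    (h2 : ∀ k : ℕ, k ≤ ⌊r⌋₊ →
      ∫ u in (0 : ℝ)..1, Real.exp (-(w (k + u) - w k)) ≤ Real.exp (ε * r)) :
    ∫ y in (0 : ℝ)..r, Real.exp (-(w y - κ / 2 * y)) ≤
      (r + 1) * Real.exp (κ / 2 * (r + 1) + 2 * ε * r) := by
  have hc : Continuous fun y => Real.exp (-(w y - κ / 2 * y)) := by fun_prop
  have hlt := Nat.lt_floor_add_one r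
  have hle := Nat.floor_le hr
  calc ∫ y in (0 : ℝ)..r, Real.exp (-(w y - κ / 2 * y))
      ≤ ∫ y in (0 : ℝ)..((⌊r⌋₊ + 1 : ℕ) : ℝ), Real.exp (-(w y - κ / 2 * y)) := by
        refine intervalIntegral.integral_mono_interval le_rfl hr (by push_cast; exact hlt.le)
          (ae_of_all _ fun y => (Real.exp_pos _).le) (hc.intervalIntegrable _ _)
    _ = ∑ k ∈ Finset.range (⌊r⌋₊ + 1),
          ∫ y in (k : ℝ)..((k + 1 : ℕ) : ℝ), Real.exp (-(w y - κ / 2 * y)) := by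
        have := intervalIntegral.sum_integral_adjacent_intervals (μ := volume)
          (a := fun k : ℕ => (k : ℝ)) (n := ⌊r⌋₊ + 1) (f := fun y => Real.exp (-(w y - κ / 2 * y)))
          (fun k _ => hc.intervalIntegrable _ _)
        simpa using this.symm
    _ ≤ ∑ k ∈ Finset.range (⌊r⌋₊ + 1), Real.exp (κ / 2 * (r + 1) + 2 * ε * r) := by
        refine Finset.sum_le_sum fun k hk => ?_
        have hk' : k ≤ ⌊r⌋₊ := by simpa [Nat.lt_succ_iff] using hk
        have hkr : (k : ℝ) ≤ r := le_trans (by exact_mod_cast hk') hle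
        have e1 : ∫ y in (k : ℝ)..((k + 1 : ℕ) : ℝ), Real.exp (-(w y - κ / 2 * y)) =
            ∫ u in (0 : ℝ)..1, Real.exp (-(w (k + u) - κ / 2 * (k + u))) := by
          have := intervalIntegral.integral_comp_add_left (a := 0) (b := 1)
            (fun y => Real.exp (-(w y - κ / 2 * y))) (k : ℝ)
          simp only [add_zero] at this
          rw [this]
          push_cast
          rfl
        rw [e1]
        calc ∫ u in (0 : ℝ)..1, Real.exp (-(w (k + u) - κ / 2 * (k + u)))
            ≤ ∫ u in (0 : ℝ)..1, Real.exp (κ / 2 * (r + 1) + ε * r) *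
                Real.exp (-(w (k + u) - w k)) := by
              refine intervalIntegral.integral_mono_on zero_le_one
                (Continuous.intervalIntegrable (by fun_prop) _ _)
                (Continuous.intervalIntegrable (by fun_prop) _ _) fun u hu => ?_
              rw [← Real.exp_add]
              refine Real.exp_le_exp.2 ?_
              have := h1 k hk'
              have : κ / 2 * (k + u) ≤ κ / 2 * (r + 1) := by
                have := hu.2
                gcongr
              linarith
          _ = Real.exp (κ / 2 * (r + 1) + ε * r) *
                ∫ u in (0 : ℝ)..1, Real.exp (-(w (k + u) - w k)) := by
              rw [intervalIntegral.integral_const_mul]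
          _ ≤ Real.exp (κ / 2 * (r + 1) + ε * r) * Real.exp (ε * r) := by
              gcongr
              exact h2 k hk'
          _ = _ := by rw [← Real.exp_add]; ring_nf
    _ ≤ _ := by
        rw [Finset.sum_const, Finset.card_range, nsmul_eq_mul]
        push_cast
        gcongr

/-- A lower bound for the exponential functional, from a bound on an exponential moment of the path
over the last unit interval. -/
theorem le_integral_exp_neg_of_moment_bound {w : ℝ → ℝ} (hw : Continuous w) {κ ε r : ℝ}
    (hκ : 0 ≤ κ) (hε : 0 ≤ ε) (hr : 1 ≤ r)
    (h : ∫ y in (r - 1)..r, Real.exp (ε * w y) ≤ Real.exp (ε * (ε * r)) / 2) :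
    Real.exp (κ / 2 * (r - 1) - ε * r) / 2 ≤
      ∫ y in (0 : ℝ)..r, Real.exp (-(w y - κ / 2 * y)) := by
  have hc : Continuous fun y => Real.exp (-(w y - κ / 2 * y)) := by fun_prop
  calc Real.exp (κ / 2 * (r - 1) - ε * r) / 2
      ≤ Real.exp (κ / 2 * (r - 1) - ε * r) *
          (1 - Real.exp (-(ε * (ε * r))) * ∫ y in (r - 1)..r, Real.exp (ε * w y)) := by
        have : Real.exp (-(ε * (ε * r))) * ∫ y in (r - 1)..r, Real.exp (ε * w y) ≤
            Real.exp (-(ε * (ε * r))) * (Real.exp (ε * (ε * r)) / 2) := by gcongr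
        rw [← mul_div_assoc, ← Real.exp_add, neg_add_cancel, Real.exp_zero] at this
        have h3 := Real.exp_pos (κ / 2 * (r - 1) - ε * r)
        nlinarith
    _ = ∫ y in (r - 1)..r, Real.exp (κ / 2 * (r - 1) - ε * r) *
          (1 - Real.exp (-(ε * (ε * r))) * Real.exp (ε * w y)) := by
        rw [intervalIntegral.integral_const_mul, intervalIntegral.integral_sub,
          intervalIntegral.integral_const_mul]
        · simp
        · simp
        · exact Continuous.intervalIntegrable (by fun_prop) _ _
    -- `exp (-w) ≥ exp (-ε r) (1 - exp (ε (w - ε r)))`: the right side is negative if `w > ε r`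
    _ ≤ ∫ y in (r - 1)..r, Real.exp (-(w y - κ / 2 * y)) := by
        refine intervalIntegral.integral_mono_on (by linarith)
          (Continuous.intervalIntegrable (by fun_prop) _ _)
          (Continuous.intervalIntegrable (by fun_prop) _ _) fun y hy => ?_
        rw [← Real.exp_add]
        rcases le_total (w y) (ε * r) with hle | hle
        · calc Real.exp (κ / 2 * (r - 1) - ε * r) * (1 - Real.exp (-(ε * (ε * r)) + ε * w y))
              ≤ Real.exp (κ / 2 * (r - 1) - ε * r) * 1 := by
                gcongr
                linarith [Real.exp_pos (-(ε * (ε * r)) + ε * w y)]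
            _ ≤ _ := by
                rw [mul_one]
                refine Real.exp_le_exp.2 ?_
                have : κ / 2 * (r - 1) ≤ κ / 2 * y := by
                  have := hy.1
                  gcongr
                linarith
        · have h1 : 1 ≤ Real.exp (-(ε * (ε * r)) + ε * w y) := by
            refine Real.one_le_exp ?_
            nlinarith
          have h3 := Real.exp_pos (κ / 2 * (r - 1) - ε * r)
          have h4 := Real.exp_pos (-(w y - κ / 2 * y))
          nlinarith
    _ ≤ _ := by
        refine intervalIntegral.integral_mono_interval (by linarith) (by linarith) le_rfl
          (ae_of_all _ fun y => (Real.exp_pos _).le) (hc.intervalIntegrable _ _)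

/-- Tonelli's theorem for the integral over `[a, b]` of the exponential of a path-continuous
process with bounded exponential moments. -/
theorem lintegral_integral_exp_le {Ω : Type*} [MeasurableSpace Ω] {P : Measure Ω}
    [IsProbabilityMeasure P] {Z : ℝ → Ω → ℝ} (hm : ∀ t, Measurable (Z t))
    (hc : ∀ ω, Continuous fun t => Z t ω) {a b C : ℝ} (hab : a ≤ b)
    (h : ∀ u ∈ Set.Ioc a b, ∫⁻ ω, ENNReal.ofReal (Real.exp (Z u ω)) ∂P ≤ ENNReal.ofReal C) :
    Measurable (fun ω => ∫ u in a..b, Real.exp (Z u ω)) ∧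
    ∫⁻ ω, ENNReal.ofReal (∫ u in a..b, Real.exp (Z u ω)) ∂P ≤ ENNReal.ofReal (C * (b - a)) := by
  have hZ : Measurable (Function.uncurry Z) := measurable_uncurry_of_continuous_of_measurable hc hm
  have hE : Measurable fun x : Ω × ℝ => Real.exp (Z x.2 x.1) :=
    Real.measurable_exp.comp (hZ.comp measurable_swap)
  constructor
  · simp_rw [intervalIntegral.integral_of_le hab]
    exact (hE.stronglyMeasurable.integral_prod_right'
      (ν := volume.restrict (Set.Ioc a b))).measurable
  have e : ∀ ω, ENNReal.ofReal (∫ u in a..b, Real.exp (Z u ω)) =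
      ∫⁻ u in Set.Ioc a b, ENNReal.ofReal (Real.exp (Z u ω)) := by
    intro ω
    rw [intervalIntegral.integral_of_le hab, ofReal_integral_eq_lintegral_ofReal]
    · exact (Continuous.integrableOn_Icc (by have := hc ω; fun_prop)).mono_set
        Set.Ioc_subset_Icc_self
    · exact ae_of_all _ fun u => (Real.exp_pos _).le
  simp_rw [e]
  rw [lintegral_lintegral_swap hE.ennreal_ofReal.aemeasurable]
  calc ∫⁻ u in Set.Ioc a b, ∫⁻ ω, ENNReal.ofReal (Real.exp (Z u ω)) ∂P
      ≤ ∫⁻ u in Set.Ioc a b, ENNReal.ofReal C := setLIntegral_mono measurable_const h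
    _ ≤ ENNReal.ofReal (C * (b - a)) := by
        rw [setLIntegral_const, Real.volume_Ioc, mul_comm C, mul_comm,
          ENNReal.ofReal_mul (by linarith)]

end BrownianPotential

namespace BrownianPotential

/-- The deviation inequality for the exponential functional, for a Brownian motion all of whose
paths are continuous. The path is compared with `± ε r` for `ε = δ / 4`; the lower bounds on `r`
ensure that `δ r / 2` dominates the remaining `log (r + 1) + κ / 2`. -/
theorem measure_log_integral_exp_deviation_le {Ω : Type*} [MeasurableSpace Ω] {P : Measure Ω}
    [IsProbabilityMeasure P] {Y : ℝ≥0 → Ω → ℝ} (hY : IsPreBrownianReal Y P)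
    (hm : ∀ t, Measurable (Y t)) (hc : ∀ ω, Continuous fun t => Y t ω) {κ δ r : ℝ} (hκ : 0 ≤ κ)
    (hδ : 0 < δ) (hr1 : 1 ≤ r) (hr2 : 16 * Real.exp (κ / 2) / δ ^ 2 ≤ r)
    (hr3 : 2 * (κ + 2) / δ ≤ r) :
    P {ω | |Real.log (∫ y in (0 : ℝ)..r, Real.exp (-(Y y.toNNReal ω - κ / 2 * y))) - κ / 2 * r|
        > δ * r} ≤
      ENNReal.ofReal ((r + 1) * (Real.exp (-(δ / 4) * (δ / 4 * r) + r * (-(δ / 4)) ^ 2 / 2) +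
          Real.exp (1 / 2) / Real.exp (δ / 4 * r)) +
        Real.exp (r * (δ / 4) ^ 2 / 2) / (Real.exp (δ / 4 * (δ / 4 * r)) / 2)) := by
  set ε := δ / 4 with hε
  have hε0 : 0 < ε := by positivity
  set n := ⌊r⌋₊ with hn
  have hle : (n : ℝ) ≤ r := Nat.floor_le (by linarith)
  -- the three kinds of exceptional events
  set U : ℕ → Set Ω := fun k => {ω | ε * r < -Y k ω} with hU
  set V : ℕ → Set Ω := fun k =>
    {ω | Real.exp (ε * r) < ∫ u in (0 : ℝ)..1, Real.exp (-(Y (k + u.toNNReal) ω - Y k ω))} with hV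
  set L : Set Ω :=
    {ω | Real.exp (ε * (ε * r)) / 2 < ∫ y in (r - 1)..r, Real.exp (ε * Y y.toNNReal ω)} with hL
  have hcr : ∀ ω, Continuous fun y : ℝ => Y y.toNNReal ω := fun ω =>
    (hc ω).comp continuous_real_toNNReal
  have hU' : ∀ k ≤ n, P (U k) ≤ ENNReal.ofReal (Real.exp (-ε * (ε * r) + r * (-ε) ^ 2 / 2)) := by
    intro k hk
    have hkr : (k : ℝ) ≤ r := le_trans (by exact_mod_cast hk) hle
    have h1 := lintegral_exp_mul_of_hasLaw_gaussianReal (hY.hasLaw_eval k) (-ε)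
    have h2 := measure_le_ofReal_div (P := P) (f := fun ω => Real.exp (-ε * Y k ω))
      (by have := hm k; fun_prop) (b := Real.exp (ε * (ε * r))) (Real.exp_pos _) h1.le (S := U k)
      (ae_of_all _ fun ω hω => Real.exp_le_exp.2 (by
        have : ε * r < -Y k ω := hω
        nlinarith))
    refine h2.trans (ENNReal.ofReal_le_ofReal ?_)
    rw [← Real.exp_sub]
    refine Real.exp_le_exp.2 ?_
    have : (k : ℝ) * (-ε) ^ 2 ≤ r * (-ε) ^ 2 := by gcongr
    simp only [NNReal.coe_natCast]
    linarith
  have hV' : ∀ k ≤ n, P (V k) ≤ ENNReal.ofReal (Real.exp (1 / 2) / Real.exp (ε * r)) := by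
    intro k _
    have h1 := lintegral_integral_exp_le (P := P)
      (Z := fun u ω => -(Y (k + u.toNNReal) ω - Y k ω)) (a := 0) (b := 1) (C := Real.exp (1 / 2))
      (fun t => ((hm _).sub (hm _)).neg)
      (fun ω => by have := hc ω; fun_prop) zero_le_one (fun u hu => by
        have := lintegral_exp_mul_of_hasLaw_gaussianReal (hY.hasLaw_sub (k + u.toNNReal) k) (-1)
        simp only [neg_one_mul, Pi.sub_apply] at this
        rw [this]
        refine ENNReal.ofReal_le_ofReal (Real.exp_le_exp.2 ?_)
        simp only [coe_nndist, Real.dist_eq, NNReal.val_eq_coe, NNReal.coe_add,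
          Real.coe_toNNReal u hu.1.le, add_sub_cancel_left, abs_of_pos hu.1]
        linarith [hu.2])
    exact measure_le_ofReal_div h1.1.aemeasurable (Real.exp_pos _) (by simpa using h1.2)
      (ae_of_all _ fun ω hω => (show _ < _ from hω).le)
  have hL' : P L ≤
      ENNReal.ofReal (Real.exp (r * ε ^ 2 / 2) / (Real.exp (ε * (ε * r)) / 2)) := by
    have h1 := lintegral_integral_exp_le (P := P) (Z := fun u ω => ε * Y u.toNNReal ω)
      (a := r - 1) (b := r) (C := Real.exp (r * ε ^ 2 / 2)) (fun t => (hm _).const_mul _)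
      (fun ω => by have := hcr ω; fun_prop) (by linarith) (fun u hu => by
        rw [lintegral_exp_mul_of_hasLaw_gaussianReal (hY.hasLaw_eval u.toNNReal) ε]
        refine ENNReal.ofReal_le_ofReal (Real.exp_le_exp.2 ?_)
        rw [Real.coe_toNNReal u (by linarith [hu.1])]
        have := hu.2
        gcongr)
    refine measure_le_ofReal_div h1.1.aemeasurable (by positivity) (by simpa using h1.2)
      (ae_of_all _ fun ω hω => (show _ < _ from hω).le)
  have hsub : {ω | |Real.log (∫ y in (0 : ℝ)..r, Real.exp (-(Y y.toNNReal ω - κ / 2 * y)))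
      - κ / 2 * r| > δ * r} ⊆ (⋃ k ∈ Finset.range (n + 1), (U k ∪ V k)) ∪ L := by
    intro ω hω
    by_contra hcon
    simp only [Set.mem_union, Set.mem_iUnion, Finset.mem_range, not_or, not_exists,
      Nat.lt_succ_iff] at hcon
    obtain ⟨hUV, hLn⟩ := hcon
    have hup := integral_exp_neg_le_of_unit_bounds (hcr ω) (ε := ε) (r := r) hκ (by linarith)
      (fun k hk => by
        have := (hUV k hk).1
        simpa [hU] using this) (fun k hk => by
        have := (hUV k hk).2
        simp only [hV, Set.mem_ofPred_eq, not_lt] at this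
        refine le_of_eq_of_le (intervalIntegral.integral_congr fun u hu => ?_) this
        rw [Set.uIcc_of_le zero_le_one] at hu
        simp only [Real.toNNReal_add k.cast_nonneg hu.1, Real.toNNReal_natCast])
    have hlow := le_integral_exp_neg_of_moment_bound (hcr ω) (κ := κ) (ε := ε) (r := r) hκ hε0.le
      hr1 (not_lt.1 hLn)
    set Sg := ∫ y in (0 : ℝ)..r, Real.exp (-(Y y.toNNReal ω - κ / 2 * y))
    have hS0 : 0 < Sg := lt_of_lt_of_le (by positivity) hlow
    change |Real.log Sg - κ / 2 * r| > δ * r at hω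
    refine absurd hω (not_lt.2 (abs_le.2 ⟨?_, ?_⟩))
    · have := Real.log_le_log (by positivity) hlow
      rw [Real.log_div (Real.exp_pos _).ne' two_ne_zero, Real.log_exp] at this
      have h2 := Real.log_two_lt_d9
      rw [div_le_iff₀ hδ] at hr3
      rw [hε] at this
      linarith
    · have := Real.log_le_log hS0 hup
      rw [Real.log_mul (by positivity) (Real.exp_pos _).ne', Real.log_exp] at this
      have h3 : Real.log (r + 1) ≤ δ * r / 2 - κ / 2 := by
        rw [Real.log_le_iff_le_exp (by positivity), Real.exp_sub, le_div_iff₀ (Real.exp_pos _)]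
        have h4 := Real.quadratic_le_exp_of_nonneg (x := δ * r / 2) (by positivity)
        rw [div_le_iff₀ (by positivity)] at hr2
        have h5 := Real.exp_pos (κ / 2)
        nlinarith [mul_pos hδ (by linarith : 0 < r),
          mul_le_mul_of_nonneg_right hr2 (by linarith : 0 ≤ r)]
      rw [hε] at this
      linarith
  refine (measure_mono hsub).trans ((measure_union_le _ _).trans ?_)
  rw [ENNReal.ofReal_add (by positivity) (by positivity)]
  refine add_le_add ?_ hL'
  calc P (⋃ k ∈ Finset.range (n + 1), (U k ∪ V k))
      ≤ ∑ k ∈ Finset.range (n + 1), P (U k ∪ V k) := measure_biUnion_finset_le _ _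
    _ ≤ ∑ k ∈ Finset.range (n + 1), ENNReal.ofReal
          (Real.exp (-ε * (ε * r) + r * (-ε) ^ 2 / 2) + Real.exp (1 / 2) / Real.exp (ε * r)) := by
        refine Finset.sum_le_sum fun k hk => ?_
        have hk' : k ≤ n := by simpa [Nat.lt_succ_iff] using hk
        rw [ENNReal.ofReal_add (by positivity) (by positivity)]
        exact (measure_union_le _ _).trans (add_le_add (hU' k hk') (hV' k hk'))
    _ ≤ _ := by
        rw [Finset.sum_const, Finset.card_range, nsmul_eq_mul, ENNReal.ofReal_mul (by positivity)]
        gcongr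
        rw [← ENNReal.ofReal_natCast]
        refine ENNReal.ofReal_le_ofReal ?_
        push_cast
        linarith

/-- The logarithm of the exponential functional of Brownian motion with drift concentrates
exponentially around the drift. -/
theorem expFunctional_deviation {κ δ : ℝ} (hκ : 0 ≤ κ) (hδ : 0 < δ) :
    ∃ c₁ c₂ r₀ : ℝ, 0 < c₁ ∧ 0 < c₂ ∧ 0 < r₀ ∧
      ∀ (Ω : Type*) [MeasurableSpace Ω] (P : Measure Ω) [IsProbabilityMeasure P]
        (B : ℝ → Ω → ℝ), IsTwoSidedBrownian B P → ∀ r : ℝ, r₀ ≤ r →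
          P.real {ω | |Real.log (expFunctional κ B r ω) - κ / 2 * r| > δ * r} ≤
            c₁ * Real.exp (-c₂ * r) := by
  set ε := δ / 4 with hε
  have hε0 : 0 < ε := by positivity
  set c := min (ε ^ 2 / 2) ε with hcdef
  have hc0 : 0 < c := lt_min (by positivity) hε0
  refine ⟨3 * (2 / c + 1) + 2, c / 2, 1 + 16 * Real.exp (κ / 2) / δ ^ 2 + 2 * (κ + 2) / δ,
    by positivity, by positivity, by positivity, ?_⟩
  intro Ω _ P _ B hB r hr
  have p1 : 0 ≤ 16 * Real.exp (κ / 2) / δ ^ 2 := by positivity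
  have p2 : 0 ≤ 2 * (κ + 2) / δ := by positivity
  have hr1 : 1 ≤ r := by linarith
  obtain ⟨Y, hYm, hYc, hYB⟩ := exists_continuous_modification
    (fun t => hB.forward.aemeasurable t) hB.forward.cont
  have hY : IsPreBrownianReal Y P := hB.forward.toIsPreBrownianReal.congr fun t => by
    filter_upwards [hYB] with ω hω using (hω t).symm
  have key := measure_log_integral_exp_deviation_le hY hYm hYc hκ hδ hr1 (by linarith)
    (by linarith : 2 * (κ + 2) / δ ≤ r)
  have hS : P {ω | |Real.log (expFunctional κ B r ω) - κ / 2 * r| > δ * r} ≤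
      P {ω | |Real.log (∫ y in (0 : ℝ)..r, Real.exp (-(Y y.toNNReal ω - κ / 2 * y))) - κ / 2 * r|
        > δ * r} := by
    refine measure_mono_ae ?_
    filter_upwards [hYB] with ω hω hm
    have : expFunctional κ B r ω =
        ∫ y in (0 : ℝ)..r, Real.exp (-(Y y.toNNReal ω - κ / 2 * y)) := by
      refine intervalIntegral.integral_congr fun y hy => ?_
      rw [Set.uIcc_of_le (by linarith)] at hy
      simp only [potential, hω, Real.coe_toNNReal y hy.1]
    change |_| > _ at hm ⊢
    rwa [this] at hm
  refine ENNReal.toReal_le_of_le_ofReal (by positivity) ((hS.trans key).trans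
    (ENNReal.ofReal_le_ofReal ?_))
  rw [← hε]
  have hcr : 0 < c * r := by positivity
  have e1 : Real.exp (-ε * (ε * r) + r * (-ε) ^ 2 / 2) ≤ Real.exp (-(c * r)) := by
    refine Real.exp_le_exp.2 ?_
    have : c * r ≤ ε ^ 2 / 2 * r := by gcongr; exact min_le_left _ _
    linarith
  have e2 : Real.exp (1 / 2) / Real.exp (ε * r) ≤ 2 * Real.exp (-(c * r)) := by
    have h2 := exp_half_le_two
    rw [div_eq_mul_inv, ← Real.exp_neg]
    have : c * r ≤ ε * r := by gcongr; exact min_le_right _ _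
    gcongr
  have e3 : Real.exp (r * ε ^ 2 / 2) / (Real.exp (ε * (ε * r)) / 2) ≤
      2 * Real.exp (-(c * r)) := by
    rw [div_div_eq_mul_div, mul_comm, mul_div_assoc, ← Real.exp_sub]
    have : c * r ≤ ε ^ 2 / 2 * r := by gcongr; exact min_le_left _ _
    gcongr
    linarith
  have e4 : r + 1 ≤ (2 / c + 1) * Real.exp (c / 2 * r) := by
    have h1 := Real.add_one_le_exp (c / 2 * r)
    have h2 : r = 2 / c * (c / 2 * r) := by field_simp
    have h3 : 0 < 2 / c := by positivity
    nlinarith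
  have e5 : Real.exp (c / 2 * r) * Real.exp (-(c * r)) = Real.exp (-(c / 2) * r) := by
    rw [← Real.exp_add]; ring_nf
  have e6 : Real.exp (-(c * r)) ≤ Real.exp (-(c / 2) * r) := Real.exp_le_exp.2 (by linarith)
  calc (r + 1) * (Real.exp (-ε * (ε * r) + r * (-ε) ^ 2 / 2) + Real.exp (1 / 2) / Real.exp (ε * r))
        + Real.exp (r * ε ^ 2 / 2) / (Real.exp (ε * (ε * r)) / 2)
      ≤ (2 / c + 1) * Real.exp (c / 2 * r) * (Real.exp (-(c * r)) + 2 * Real.exp (-(c * r)))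
        + 2 * Real.exp (-(c * r)) := by gcongr
    _ = 3 * (2 / c + 1) * (Real.exp (c / 2 * r) * Real.exp (-(c * r)))
        + 2 * Real.exp (-(c * r)) := by ring
    _ ≤ 3 * (2 / c + 1) * Real.exp (-(c / 2) * r) + 2 * Real.exp (-(c / 2) * r) := by
        rw [e5]; gcongr
    _ = _ := by ring

end BrownianPotential

/-! ### Test functions and their one-step Gaussian estimate -/

namespace BrownianPotential

/-- `F` is three times continuously differentiable, bounded below by `1 / C > 0`, and its first
three derivatives are bounded by `C` in absolute value. -/
structure IsTestFunction (F : ℝ → ℝ) (C : ℝ) : Prop where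
  contDiff : ContDiff ℝ 3 F
  pos : ∀ x, 0 < F x
  one_le : ∀ x, 1 ≤ C * F x
  deriv_le : ∀ x, |iteratedDeriv 1 F x| ≤ C
  deriv_two_le : ∀ x, |iteratedDeriv 2 F x| ≤ C
  deriv_three_le : ∀ x, |iteratedDeriv 3 F x| ≤ C

theorem IsTestFunction.const_nonneg {F : ℝ → ℝ} {C : ℝ} (hF : IsTestFunction F C) : 0 ≤ C :=
  (abs_nonneg _).trans (hF.deriv_le 0)

/-- The second-order Taylor bound for a test function. -/
theorem IsTestFunction.le_taylor {F : ℝ → ℝ} {C : ℝ} (hF : IsTestFunction F C) (z u : ℝ) :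
    F (z + u) ≤ F z + iteratedDeriv 1 F z * u + iteratedDeriv 2 F z * u ^ 2 / 2 +
      C * |u| ^ 3 / 6 := by
  rcases eq_or_ne u 0 with rfl | hu
  · simp
  have hne : z ≠ z + u := by simpa using hu
  obtain ⟨x', -, hx'⟩ := taylor_mean_remainder_lagrange_iteratedDeriv (n := 2) hne
    (by norm_num; exact hF.contDiff.contDiffOn)
  have hun : UniqueDiffOn ℝ (Set.uIcc z (z + u)) := by
    rcases lt_or_gt_of_ne hne with h | h
    · rw [Set.uIcc_of_le h.le]; exact uniqueDiffOn_Icc h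
    · rw [Set.uIcc_of_ge h.le]; exact uniqueDiffOn_Icc h
  have hd : ∀ k : ℕ, k ≤ 3 → iteratedDerivWithin k F (Set.uIcc z (z + u)) z =
      iteratedDeriv k F z := fun k hk =>
    iteratedDerivWithin_eq_iteratedDeriv hun
      ((hF.contDiff.of_le (by exact_mod_cast hk)).contDiffAt) Set.left_mem_uIcc
  rw [taylorWithinEval_succ, taylorWithinEval_succ, taylor_within_zero_eval, hd _ (by norm_num),
    hd _ (by norm_num)] at hx'
  have h3 : iteratedDeriv 3 F x' * u ^ 3 ≤ C * |u| ^ 3 := by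
    refine (le_abs_self _).trans ?_
    rw [abs_mul, abs_pow]
    have := hF.deriv_three_le x'
    gcongr
  simp only [add_sub_cancel_left, smul_eq_mul] at hx'
  norm_num [Nat.factorial] at hx'
  have e : F (z + u) = F z + iteratedDeriv 1 F z * u + iteratedDeriv 2 F z * u ^ 2 / 2 +
      iteratedDeriv 3 F x' * u ^ 3 / 6 := by
    rw [iteratedDeriv_one]
    linarith
  rw [e]
  linarith

theorem integral_sq_gaussianReal (v : ℝ≥0) : ∫ g, g ^ 2 ∂gaussianReal 0 v = v := by
  have h := variance_of_integral_eq_zero (μ := gaussianReal 0 v) (X := id) aemeasurable_id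
    (by simp)
  rw [variance_id_gaussianReal] at h
  simpa using h.symm

theorem integral_exp_mul_gaussianReal (v : ℝ≥0) (l : ℝ) :
    ∫ g, Real.exp (l * g) ∂gaussianReal 0 v = Real.exp (v * l ^ 2 / 2) := by
  have h := mgf_gaussianReal (p := gaussianReal 0 v) (X := id) (μ := 0) (v := v) (by simp) l
  simpa [mgf] using h

theorem abs_pow_three_le_exp {s : ℝ} (hs : 0 < s) (g : ℝ) :
    |g| ^ 3 ≤ 6 * s ^ 3 * (Real.exp (s⁻¹ * g) + Real.exp (-s⁻¹ * g)) := by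
  have h1 := Real.pow_div_factorial_le_exp (|s⁻¹ * g|) (abs_nonneg _) 3
  have h2 : Real.exp |s⁻¹ * g| ≤ Real.exp (s⁻¹ * g) + Real.exp (-s⁻¹ * g) := by
    rw [neg_mul]; exact Real.exp_abs_le _
  have e : |g| ^ 3 = 6 * s ^ 3 * (|s⁻¹ * g| ^ 3 / (Nat.factorial 3 : ℝ)) := by
    rw [abs_mul, abs_of_pos (inv_pos.2 hs)]
    norm_num [Nat.factorial]
    field_simp
  rw [e]
  exact mul_le_mul_of_nonneg_left (h1.trans h2) (by positivity)

/-- One step of an Euler scheme with drift `d` and diffusion coefficient `2 ρ`: up to an error of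
order `v √v`, the mean of a test function grows exponentially with the rate given by the
generator. In the error, `d ^ 2` comes from the square of the drift, and the other two terms from
the cubic Taylor remainder; one factor `C` bounds the derivatives and the other one `1 / F`. -/
theorem IsTestFunction.lintegral_step_le {F : ℝ → ℝ} {C : ℝ} (hF : IsTestFunction F C)
    {d K : ℝ} (hd : 0 ≤ d) {ρ : ℝ} (hρ : 0 ≤ ρ) (hρK : ρ ≤ K) (z : ℝ) {v : ℝ≥0}
    (hv : 0 < v) (hv1 : v ≤ 1) :
    ∫⁻ g, ENNReal.ofReal (F (z + (2 * ρ * g + d * v))) ∂gaussianReal 0 v ≤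
      ENNReal.ofReal (F z * Real.exp
        ((d * iteratedDeriv 1 F z + 2 * ρ ^ 2 * iteratedDeriv 2 F z) / F z * v +
          C ^ 2 * (d ^ 2 + 128 * K ^ 3 + d ^ 3) * (v * √v))) := by
  set s : ℝ := √v with hs
  have hvr : (0 : ℝ) < v := by exact_mod_cast hv
  have hv1r : (v : ℝ) ≤ 1 := by exact_mod_cast hv1
  have hs0 : 0 < s := Real.sqrt_pos.2 hvr
  have hss : s * s = v := Real.mul_self_sqrt hvr.le
  have hs1 : s ≤ 1 := by nlinarith
  have hC := hF.const_nonneg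
  have hK : 0 ≤ K := hρ.trans hρK
  set a := iteratedDeriv 1 F z with ha
  set b := iteratedDeriv 2 F z with hb
  -- the coefficients of a function of the Gaussian variable which dominates the Taylor expansion:
  -- `A0`, `A1`, `A2` for the polynomial part, `A3` for the exponential bound of the cubic remainder
  set A0 := F z + a * (d * v) + b * (d * v) ^ 2 / 2 + 2 / 3 * C * (d * v) ^ 3 with hA0
  set A1 := 2 * ρ * a + 2 * ρ * (d * v) * b with hA1
  set A2 := 2 * ρ ^ 2 * b with hA2
  set A3 := 32 * C * K ^ 3 * s ^ 3 with hA3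
  have hpt : ∀ g, F (z + (2 * ρ * g + d * v)) ≤
      A0 + A1 * g + A2 * g ^ 2 + A3 * (Real.exp (s⁻¹ * g) + Real.exp (-s⁻¹ * g)) := by
    intro g
    refine (hF.le_taylor z _).trans ?_
    have h1 : |2 * ρ * g + d * v| ^ 3 ≤ 4 * (8 * K ^ 3 * |g| ^ 3 + (d * v) ^ 3) := by
      have hab : |2 * ρ * g + d * v| ≤ 2 * K * |g| + d * v := by
        refine (abs_add_le _ _).trans ?_
        rw [abs_mul, abs_of_nonneg (by positivity : 0 ≤ 2 * ρ),
          abs_of_nonneg (by positivity : 0 ≤ d * v)]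
        gcongr
      have hcube : ∀ x y : ℝ, 0 ≤ x → 0 ≤ y → (x + y) ^ 3 ≤ 4 * (x ^ 3 + y ^ 3) := by
        intro x y hx hy
        nlinarith [mul_nonneg (add_nonneg hx hy) (sq_nonneg (x - y))]
      calc |2 * ρ * g + d * v| ^ 3 ≤ (2 * K * |g| + d * v) ^ 3 := by gcongr
        _ ≤ 4 * ((2 * K * |g|) ^ 3 + (d * v) ^ 3) := hcube _ _ (by positivity) (by positivity)
        _ = _ := by ring
    have h2 := abs_pow_three_le_exp hs0 g
    have h3 : C * |2 * ρ * g + d * v| ^ 3 ≤ C * (4 * (8 * K ^ 3 * (6 * s ^ 3 *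
        (Real.exp (s⁻¹ * g) + Real.exp (-s⁻¹ * g))) + (d * v) ^ 3)) := by
      refine mul_le_mul_of_nonneg_left (h1.trans ?_) hC
      gcongr
    rw [hA0, hA1, hA2, hA3]
    linarith
  have hi1 : Integrable (fun g : ℝ => g) (gaussianReal 0 v) :=
    (memLp_id_gaussianReal 1).integrable le_rfl
  have hi2 : Integrable (fun g : ℝ => g ^ 2) (gaussianReal 0 v) :=
    (memLp_id_gaussianReal 2).integrable_sq
  have hi3 : Integrable (fun g : ℝ => Real.exp (s⁻¹ * g) + Real.exp (-s⁻¹ * g))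
      (gaussianReal 0 v) :=
    (integrable_exp_mul_gaussianReal _).add (integrable_exp_mul_gaussianReal _)
  have hint : Integrable (fun g => A0 + A1 * g + A2 * g ^ 2 +
      A3 * (Real.exp (s⁻¹ * g) + Real.exp (-s⁻¹ * g))) (gaussianReal 0 v) :=
    (((integrable_const _).add (hi1.const_mul _)).add (hi2.const_mul _)).add (hi3.const_mul _)
  have hval : ∫ g, (A0 + A1 * g + A2 * g ^ 2 +
      A3 * (Real.exp (s⁻¹ * g) + Real.exp (-s⁻¹ * g))) ∂gaussianReal 0 v =
      A0 + A2 * v + A3 * (2 * Real.exp (1 / 2)) := by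
    have j1 : Integrable (fun g => A0 + A1 * g) (gaussianReal 0 v) :=
      (integrable_const _).add (hi1.const_mul _)
    have j2 : Integrable (fun g => A0 + A1 * g + A2 * g ^ 2) (gaussianReal 0 v) :=
      j1.add (hi2.const_mul _)
    rw [integral_add j2 (hi3.const_mul _), integral_add j1 (hi2.const_mul _),
      integral_add (integrable_const _) (hi1.const_mul _),
      integral_const_mul, integral_const_mul, integral_const_mul, integral_sq_gaussianReal,
      integral_add (integrable_exp_mul_gaussianReal _) (integrable_exp_mul_gaussianReal _),
      integral_exp_mul_gaussianReal, integral_exp_mul_gaussianReal, integral_id_gaussianReal]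
    have e : (v : ℝ) * s⁻¹ ^ 2 / 2 = 1 / 2 := by rw [← hss]; field_simp
    rw [neg_sq, e, integral_const, probReal_univ, one_smul]
    ring
  calc ∫⁻ g, ENNReal.ofReal (F (z + (2 * ρ * g + d * v))) ∂gaussianReal 0 v
      ≤ ∫⁻ g, ENNReal.ofReal (A0 + A1 * g + A2 * g ^ 2 +
          A3 * (Real.exp (s⁻¹ * g) + Real.exp (-s⁻¹ * g))) ∂gaussianReal 0 v :=
        lintegral_mono fun g => ENNReal.ofReal_le_ofReal (hpt g)
    _ = ENNReal.ofReal (A0 + A2 * v + A3 * (2 * Real.exp (1 / 2))) := by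
        rw [← ofReal_integral_eq_lintegral_ofReal hint
          (ae_of_all _ fun g => (hF.pos _).le.trans (hpt g)), hval]
    _ ≤ _ := by
        refine ENNReal.ofReal_le_ofReal ?_
        have hexp := exp_half_le_two
        have hs3 : s ^ 3 = v * s := by rw [← hss]; ring
        have hv2 : (v : ℝ) ^ 2 ≤ v * s := by
          have : (v : ℝ) ≤ s := by nlinarith
          nlinarith
        have hv3 : (v : ℝ) ^ 3 ≤ v * s := by nlinarith [mul_pos hvr hs0]
        have h1 : b * (d * v) ^ 2 / 2 ≤ C * d ^ 2 * (v * s) := by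
          have hbC : b ≤ C := (le_abs_self _).trans (hF.deriv_two_le z)
          calc b * (d * v) ^ 2 / 2 ≤ C * (d * v) ^ 2 / 2 := by gcongr
            _ = C * d ^ 2 * v ^ 2 / 2 := by ring
            _ ≤ C * d ^ 2 * v ^ 2 := half_le_self (by positivity)
            _ ≤ _ := by gcongr
        have h2 : 2 / 3 * C * (d * v) ^ 3 ≤ C * d ^ 3 * (v * s) := by
          calc 2 / 3 * C * (d * v) ^ 3 = 2 / 3 * (C * d ^ 3 * v ^ 3) := by ring
            _ ≤ 1 * (C * d ^ 3 * v ^ 3) := by gcongr; norm_num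
            _ ≤ _ := by rw [one_mul]; gcongr
        have h3 : A3 * (2 * Real.exp (1 / 2)) ≤ C * (128 * K ^ 3) * (v * s) := by
          calc A3 * (2 * Real.exp (1 / 2)) ≤ A3 * (2 * 2) := by gcongr
            _ = _ := by rw [hA3, hs3]; ring
        set E := C * (d ^ 2 + 128 * K ^ 3 + d ^ 3) * (v * s) with hE
        have hE0 : 0 ≤ E := by positivity
        have hEF : E ≤ F z * (C ^ 2 * (d ^ 2 + 128 * K ^ 3 + d ^ 3) * (v * s)) := by
          have := mul_le_mul_of_nonneg_left (hF.one_le z) hE0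
          rw [hE] at this ⊢
          linarith
        have hFz := hF.pos z
        have hexp2 := Real.add_one_le_exp ((d * a + 2 * ρ ^ 2 * b) / F z * v +
          C ^ 2 * (d ^ 2 + 128 * K ^ 3 + d ^ 3) * (v * s))
        have hfin := mul_le_mul_of_nonneg_left hexp2 hFz.le
        have hcanc : F z * ((d * a + 2 * ρ ^ 2 * b) / F z * v) = (d * a + 2 * ρ ^ 2 * b) * v := by
          field_simp
        rw [hA0, hA2]
        rw [hE] at hEF
        linarith

/-- A power of `x + ε` on `[0, M]` extends to a test function on the whole line. -/
theorem exists_isTestFunction_eq_rpow {ε : ℝ} (hε : 0 < ε) (p : ℝ) {M : ℝ} (hM : 0 ≤ M) :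
    ∃ F C, IsTestFunction F C ∧ ∀ x ∈ Set.Icc 0 M, F x = (x + ε) ^ p ∧
      iteratedDeriv 1 F x = p * (x + ε) ^ (p - 1) ∧
      iteratedDeriv 2 F x = p * (p - 1) * (x + ε) ^ (p - 2) := by
  let χ : ContDiffBump (M / 2) := ⟨M / 2 + ε / 4, M / 2 + ε / 2, by linarith, by linarith⟩
  set H : ℝ → ℝ := fun x => χ x * ((x + ε) ^ p - 1) with hH
  have hzero : ∀ x, x < -(ε / 2) → χ x = 0 := fun x hx => χ.zero_of_le_dist (by
    rw [Real.dist_eq, abs_of_neg (by linarith)]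
    change M / 2 + ε / 2 ≤ _
    linarith)
  have hone : ∀ x, -(ε / 4) < x → x < M + ε / 4 → χ x = 1 := fun x h1 h2 =>
    χ.one_of_mem_closedBall (by
      rw [Metric.mem_closedBall, Real.dist_eq, abs_le]
      change -(M / 2 + ε / 4) ≤ _ ∧ _ ≤ M / 2 + ε / 4
      constructor <;> linarith)
  have hpow : ∀ x, -ε < x → ContDiffAt ℝ 3 (fun x : ℝ => (x + ε) ^ p) x := fun x hx =>
    (contDiffAt_id.add contDiffAt_const).rpow_const_of_ne
      (by simp only [id]; linarith : (id x + ε : ℝ) ≠ 0)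
  have hHc : ContDiff ℝ 3 H := by
    refine contDiff_iff_contDiffAt.2 fun x => ?_
    rcases lt_or_ge x (-(ε / 2)) with hx | hx
    · have : H =ᶠ[nhds x] fun _ => 0 := by
        filter_upwards [Iio_mem_nhds hx] with y hy
        simp [hH, hzero y hy]
      exact contDiffAt_const.congr_of_eventuallyEq this
    · exact χ.contDiffAt.mul ((hpow x (by linarith)).sub contDiffAt_const)
  have hHs : HasCompactSupport H := χ.hasCompactSupport.mul_right
  set F : ℝ → ℝ := fun x => 1 + H x with hFdef
  have hFc : ContDiff ℝ 3 F := contDiff_const.add hHc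
  have hFpos : ∀ x, 0 < F x := by
    intro x
    have e : F x = (1 - χ x) + χ x * (x + ε) ^ p := by simp only [hFdef, hH]; ring
    rcases lt_or_ge x (-(ε / 2)) with hx | hx
    · rw [e, hzero x hx]; norm_num
    · have h1 : 0 < (x + ε) ^ p := Real.rpow_pos_of_pos (by linarith) _
      rw [e]
      rcases eq_or_lt_of_le (χ.nonneg (x := x)) with h | h
      · rw [← h]; norm_num
      · have := χ.le_one (x := x)
        have := mul_pos h h1
        linarith
  have hinv : HasCompactSupport fun x => (F x)⁻¹ - 1 :=
    hHs.comp_left (g := fun y => (1 + y)⁻¹ - 1) (by simp)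
  obtain ⟨C0, hC0⟩ := hinv.exists_bound_of_continuous
    ((hFc.continuous.inv₀ fun x => (hFpos x).ne').sub continuous_const)
  have hder : ∀ k : ℕ, 0 < k → k ≤ 3 → ∃ C, ∀ x, |iteratedDeriv k F x| ≤ C := by
    intro k hk0 hk
    have e : iteratedDeriv k F = iteratedDeriv k H := by
      ext x
      exact iteratedDeriv_const_add (n := k) hk0 1
    rw [e]
    have hs : HasCompactSupport (iteratedDeriv k H) := by
      rw [iteratedDeriv_eq_iterate]
      clear hk e hk0
      induction k with
      | zero => exact hHs
      | succ k ih => rw [Function.iterate_succ_apply']; exact ih.deriv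
    obtain ⟨C, hC⟩ := hs.exists_bound_of_continuous
      (hHc.continuous_iteratedDeriv k (by exact_mod_cast hk))
    exact ⟨C, hC⟩
  obtain ⟨C1, hC1⟩ := hder 1 (by norm_num) (by norm_num)
  obtain ⟨C2, hC2⟩ := hder 2 (by norm_num) (by norm_num)
  obtain ⟨C3, hC3⟩ := hder 3 (by norm_num) (by norm_num)
  have b1 : 0 ≤ C1 := (abs_nonneg _).trans (hC1 0)
  have b2 : 0 ≤ C2 := (abs_nonneg _).trans (hC2 0)
  have b3 : 0 ≤ C3 := (abs_nonneg _).trans (hC3 0)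
  have b0 : 0 ≤ C0 := (norm_nonneg _).trans (hC0 0)
  refine ⟨F, C0 + 1 + C1 + C2 + C3, ⟨hFc, hFpos, fun x => ?_, fun x => ?_, fun x => ?_,
    fun x => ?_⟩, fun x hx => ?_⟩
  · have h1 : (F x)⁻¹ ≤ C0 + 1 + C1 + C2 + C3 := by
      have := (le_abs_self _).trans (hC0 x)
      linarith
    have := mul_le_mul_of_nonneg_right h1 (hFpos x).le
    rwa [inv_mul_cancel₀ (hFpos x).ne'] at this
  · linarith [hC1 x]
  · linarith [hC2 x]
  · linarith [hC3 x]
  · have hev : F =ᶠ[nhds x] fun y => (y + ε) ^ p := by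
      filter_upwards [Ioo_mem_nhds (by linarith [hx.1] : -(ε / 4) < x)
        (by linarith [hx.2] : x < M + ε / 4)] with y hy
      simp [hFdef, hH, hone y hy.1 hy.2]
    have hd : ∀ q y : ℝ, 0 < y + ε → HasDerivAt (fun y : ℝ => (y + ε) ^ q)
        (q * (y + ε) ^ (q - 1)) y := by
      intro q y hy
      have := ((hasDerivAt_id y).add_const ε).rpow_const (p := q) (Or.inl hy.ne')
      simpa using this
    have hxε : 0 < x + ε := by linarith [hx.1]
    have hd1 : deriv (fun y : ℝ => (y + ε) ^ p) =ᶠ[nhds x]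
        fun y => p * (y + ε) ^ (p - 1) := by
      filter_upwards [Ioi_mem_nhds (by linarith : -ε < x)] with y hy
      have hy' : -ε < y := hy
      exact (hd p y (by linarith)).deriv
    refine ⟨hev.self_of_nhds, ?_, ?_⟩
    · rw [hev.iteratedDeriv_eq 1, iteratedDeriv_one]
      exact hd1.self_of_nhds
    · rw [hev.iteratedDeriv_eq 2, iteratedDeriv_succ, iteratedDeriv_one, hd1.deriv_eq]
      have := ((hd (p - 1) x hxε).const_mul p).deriv
      rw [this]
      ring_nf

end BrownianPotential

/-! ### The killed exponential supermartingale of the Euler scheme -/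

namespace BrownianPotential

/-- The `i`-th point of the dyadic grid of mesh `2⁻ⁿ`, stopped at `t`. -/
noncomputable def gridTime (n : ℕ) (t : ℝ≥0) (i : ℕ) : ℝ≥0 := min ((i : ℝ≥0) / 2 ^ n) t

theorem gridTime_mono (n : ℕ) (t : ℝ≥0) : Monotone (gridTime n t) := fun i j h => by
  unfold gridTime
  gcongr

theorem gridTime_of_lt_ceil {n : ℕ} {t : ℝ≥0} {i : ℕ} (hi : i < ⌈t * 2 ^ n⌉₊) :
    gridTime n t i = (i : ℝ≥0) / 2 ^ n := by
  refine min_eq_left ?_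
  rw [div_le_iff₀ (by positivity)]
  exact (Nat.lt_ceil.1 hi).le

theorem gridTime_ceil (n : ℕ) (t : ℝ≥0) : gridTime n t ⌈t * 2 ^ n⌉₊ = t := by
  refine min_eq_right ?_
  rw [le_div_iff₀ (by positivity)]
  exact Nat.le_ceil _

theorem gridTime_lt_succ {n : ℕ} {t : ℝ≥0} {i : ℕ} (hi : i < ⌈t * 2 ^ n⌉₊) :
    gridTime n t i < gridTime n t (i + 1) := by
  rw [gridTime_of_lt_ceil hi]
  refine lt_min ?_ ?_
  · gcongr
    simp
  · rw [div_lt_iff₀ (by positivity)]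
    exact Nat.lt_ceil.1 hi

theorem gridTime_succ_le (n : ℕ) (t : ℝ≥0) (i : ℕ) :
    gridTime n t (i + 1) ≤ gridTime n t i + (2 ^ n)⁻¹ := by
  unfold gridTime
  rcases le_total ((i : ℝ≥0) / 2 ^ n) t with h | h
  · rw [min_eq_left h]
    refine (min_le_left _ _).trans ?_
    push_cast
    rw [add_div, one_div]
  · rw [min_eq_right h]
    exact (min_le_right _ _).trans le_self_add

/-- The length of the `i`-th step of the stopped dyadic grid. -/
noncomputable def gridStep (n : ℕ) (t : ℝ≥0) (i : ℕ) : ℝ≥0 :=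
  gridTime n t (i + 1) - gridTime n t i

theorem coe_gridStep (n : ℕ) (t : ℝ≥0) (i : ℕ) :
    (gridStep n t i : ℝ) = gridTime n t (i + 1) - gridTime n t i :=
  NNReal.coe_sub (gridTime_mono n t i.le_succ)

theorem gridStep_pos {n : ℕ} {t : ℝ≥0} {i : ℕ} (hi : i < ⌈t * 2 ^ n⌉₊) : 0 < gridStep n t i :=
  tsub_pos_of_lt (gridTime_lt_succ hi)

theorem gridStep_le (n : ℕ) (t : ℝ≥0) (i : ℕ) : gridStep n t i ≤ (2 ^ n)⁻¹ :=
  tsub_le_iff_left.2 (gridTime_succ_le n t i)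

variable {Ω : Type*}

/-- The approximation of `R ^ 2` along the stopped dyadic grid which has the increments
`2 R dγ + d dt` with the coefficient `R` frozen at the left end of each step. -/
noncomputable def eulerScheme (d x : ℝ) (R γ : ℝ≥0 → Ω → ℝ) (n : ℕ) (t : ℝ≥0) (i : ℕ) (ω : Ω) : ℝ :=
  x ^ 2 + d * gridTime n t i + ∑ j ∈ Finset.range i, 2 * R ((j : ℝ≥0) / 2 ^ n) ω *
    (γ (min (((j : ℝ≥0) + 1) / 2 ^ n) t) ω - γ ((j : ℝ≥0) / 2 ^ n) ω)

theorem eulerScheme_zero (d x : ℝ) (R γ : ℝ≥0 → Ω → ℝ) (n : ℕ) (t : ℝ≥0) (ω : Ω) :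
    eulerScheme d x R γ n t 0 ω = x ^ 2 := by
  simp [eulerScheme, gridTime]

theorem eulerScheme_succ (d x : ℝ) (R γ : ℝ≥0 → Ω → ℝ) {n : ℕ} {t : ℝ≥0} {i : ℕ}
    (hi : i < ⌈t * 2 ^ n⌉₊) (ω : Ω) :
    eulerScheme d x R γ n t (i + 1) ω = eulerScheme d x R γ n t i ω +
      (2 * R (gridTime n t i) ω * (γ (gridTime n t (i + 1)) ω - γ (gridTime n t i) ω) +
        d * gridStep n t i) := by
  rw [eulerScheme, eulerScheme, Finset.sum_range_succ, coe_gridStep]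
  have e : gridTime n t (i + 1) = min (((i : ℝ≥0) + 1) / 2 ^ n) t := by
    rw [gridTime]; push_cast; rfl
  rw [e, gridTime_of_lt_ceil hi]
  ring

/-- The relative growth rate `(d F' + 2 ρ² F'') / F` at `z` of a function `F` of a process with
drift `d` and diffusion coefficient `2 ρ`. -/
noncomputable def growthRate (d : ℝ) (F : ℝ → ℝ) (z ρ : ℝ) : ℝ :=
  (d * iteratedDeriv 1 F z + 2 * ρ ^ 2 * iteratedDeriv 2 F z) / F z

/-- The factor by which the weight of a path is multiplied in a step of length `v`: it
compensates for the growth of `F`, and it kills the path if the coefficient `ρ` is not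
in `[0, K]`. -/
noncomputable def stepWeight (d : ℝ) (F : ℝ → ℝ) (C K : ℝ) (v : ℝ≥0) (z ρ : ℝ) : ℝ :=
  (Set.Icc 0 K).indicator (fun ρ => Real.exp (-(growthRate d F z ρ * v +
    C ^ 2 * (d ^ 2 + 128 * K ^ 3 + d ^ 3) * (v * √v)))) ρ

theorem IsTestFunction.continuous_iteratedDeriv {F : ℝ → ℝ} {C : ℝ} (hF : IsTestFunction F C)
    {k : ℕ} (hk : k ≤ 3) : Continuous (iteratedDeriv k F) :=
  hF.contDiff.continuous_iteratedDeriv k (by exact_mod_cast hk)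

theorem IsTestFunction.continuous_growthRate {F : ℝ → ℝ} {C : ℝ} (hF : IsTestFunction F C)
    (d : ℝ) : Continuous fun q : ℝ × ℝ => growthRate d F q.1 q.2 := by
  have h0 := hF.contDiff.continuous
  have h1 := hF.continuous_iteratedDeriv (k := 1) (by norm_num)
  have h2 := hF.continuous_iteratedDeriv (k := 2) (by norm_num)
  unfold growthRate
  exact Continuous.div (by fun_prop) (by fun_prop) fun q => (hF.pos _).ne'

theorem IsTestFunction.measurable_stepWeight {F : ℝ → ℝ} {C : ℝ} (hF : IsTestFunction F C)
    (d K : ℝ) (v : ℝ≥0) : Measurable fun q : ℝ × ℝ => stepWeight d F C K v q.1 q.2 := by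
  have h := (hF.continuous_growthRate d).measurable
  have : (fun q : ℝ × ℝ => stepWeight d F C K v q.1 q.2) =
      (Prod.snd ⁻¹' Set.Icc 0 K).indicator fun q : ℝ × ℝ =>
        Real.exp (-(growthRate d F q.1 q.2 * v +
          C ^ 2 * (d ^ 2 + 128 * K ^ 3 + d ^ 3) * (v * √v))) := by
    ext q
    by_cases hq : q.2 ∈ Set.Icc 0 K <;> simp [stepWeight, hq]
  rw [this]
  exact Measurable.indicator (by fun_prop) (measurable_snd measurableSet_Icc)

/-- The weight compensates for one Gaussian step. -/
theorem IsTestFunction.lintegral_step_mul_stepWeight_le {F : ℝ → ℝ} {C : ℝ}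
    (hF : IsTestFunction F C) {d : ℝ} (hd : 0 ≤ d) (K : ℝ) {v : ℝ≥0} (hv : 0 < v) (hv1 : v ≤ 1)
    (z ρ w : ℝ) :
    ∫⁻ g, ENNReal.ofReal (F (z + (2 * ρ * g + d * v)) * (w * stepWeight d F C K v z ρ))
      ∂gaussianReal 0 v ≤ ENNReal.ofReal (F z * w) := by
  by_cases hρ : ρ ∈ Set.Icc 0 K
  · have h := hF.lintegral_step_le hd hρ.1 hρ.2 z hv hv1
    have e : stepWeight d F C K v z ρ = Real.exp (-(growthRate d F z ρ * v +
        C ^ 2 * (d ^ 2 + 128 * K ^ 3 + d ^ 3) * (v * √v))) := by simp [stepWeight, hρ]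
    rw [← growthRate] at h
    rw [e]
    set E := growthRate d F z ρ * v + C ^ 2 * (d ^ 2 + 128 * K ^ 3 + d ^ 3) * (v * √v)
    simp_rw [ENNReal.ofReal_mul (hF.pos _).le]
    have hFm : Measurable fun g : ℝ => ENNReal.ofReal (F (z + (2 * ρ * g + d * v))) := by
      have := hF.contDiff.continuous
      fun_prop
    rw [lintegral_mul_const _ hFm]
    refine (mul_le_mul_left h _).trans_eq ?_
    rw [← ENNReal.ofReal_mul (mul_nonneg (hF.pos z).le (Real.exp_pos _).le),
      ← ENNReal.ofReal_mul (hF.pos z).le]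
    congr 1
    calc F z * Real.exp E * (w * Real.exp (-E)) = F z * w * (Real.exp E * Real.exp (-E)) := by ring
      _ = F z * w := by rw [← Real.exp_add, add_neg_cancel, Real.exp_zero, mul_one]
  · simp [stepWeight, hρ]

/-- The product of the weights along the first `i` steps. -/
noncomputable def pathWeight (d x : ℝ) (F : ℝ → ℝ) (C K : ℝ) (R γ : ℝ≥0 → Ω → ℝ) (n : ℕ) (t : ℝ≥0)
    (i : ℕ) (ω : Ω) : ℝ :=
  ∏ j ∈ Finset.range i, stepWeight d F C K (gridStep n t j) (eulerScheme d x R γ n t j ω)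
    (R (gridTime n t j) ω)

variable [mΩ : MeasurableSpace Ω] {P : Measure Ω} {γ R : ℝ≥0 → Ω → ℝ} {𝓕 : Filtration ℝ≥0 mΩ}

theorem IsTestFunction.measurable_pathWeight_eulerScheme {F : ℝ → ℝ} {C : ℝ}
    (hF : IsTestFunction F C) (hγ : StronglyAdapted 𝓕 γ) (hR : StronglyAdapted 𝓕 R) (d x K : ℝ)
    (n : ℕ) (t : ℝ≥0) {i : ℕ} (hi : i ≤ ⌈t * 2 ^ n⌉₊) :
    Measurable[𝓕 (gridTime n t i)] fun ω =>
      (pathWeight d x F C K R γ n t i ω, eulerScheme d x R γ n t i ω) := by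
  induction i with
  | zero =>
    simp only [pathWeight, Finset.range_zero, Finset.prod_empty, eulerScheme_zero]
    exact measurable_const
  | succ i ih =>
    have hi' : i < ⌈t * 2 ^ n⌉₊ := hi
    have hle := 𝓕.mono (gridTime_mono n t i.le_succ)
    set v := gridStep n t i
    let Ψ : (ℝ × ℝ) × (ℝ × ℝ × ℝ) → ℝ × ℝ := fun q =>
      (q.1.1 * stepWeight d F C K v q.1.2 q.2.1,
        q.1.2 + (2 * q.2.1 * (q.2.2.1 - q.2.2.2) + d * v))
    have hΨ : Measurable Ψ := by
      have := (hF.measurable_stepWeight d K v).comp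
        (f := fun q : (ℝ × ℝ) × (ℝ × ℝ × ℝ) => (q.1.2, q.2.1)) (by fun_prop)
      refine Measurable.prodMk ((measurable_fst.comp measurable_fst).mul this) (by fun_prop)
    have hmeas := hΨ.comp (((ih hi'.le).mono hle le_rfl).prodMk
      (((hR (gridTime n t i)).measurable.mono hle le_rfl).prodMk
        ((hγ (gridTime n t (i + 1))).measurable.prodMk
          ((hγ (gridTime n t i)).measurable.mono hle le_rfl))))
    convert hmeas using 1
    ext ω
    · simp [Ψ, pathWeight, Finset.prod_range_succ, v]
    · simp [Ψ, eulerScheme_succ d x R γ hi', v]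

/-- The test function of the Euler scheme, weighted by the path weights, has expectation at most its
initial value, because every step decreases the expectation. -/
theorem IsTestFunction.lintegral_pathWeight_le [IsProbabilityMeasure P] {F : ℝ → ℝ} {C : ℝ}
    (hF : IsTestFunction F C) (hγ : IsBrownianWrt γ 𝓕 P) (hR : StronglyAdapted 𝓕 R) {d : ℝ}
    (hd : 0 ≤ d) (x K : ℝ) (n : ℕ) (t : ℝ≥0) {i : ℕ} (hi : i ≤ ⌈t * 2 ^ n⌉₊) :
    ∫⁻ ω, ENNReal.ofReal (F (eulerScheme d x R γ n t i ω) * pathWeight d x F C K R γ n t i ω) ∂P ≤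
      ENNReal.ofReal (F (x ^ 2)) := by
  induction i with
  | zero => simp [pathWeight, eulerScheme_zero]
  | succ i ih =>
    have hi' : i < ⌈t * 2 ^ n⌉₊ := hi
    refine le_trans ?_ (ih hi'.le)
    set v := gridStep n t i with hv
    have hlt := gridTime_lt_succ hi'
    have hv0 : 0 < v := gridStep_pos hi'
    have hv1 : v ≤ 1 := (gridStep_le n t i).trans (inv_le_one_of_one_le₀ (one_le_pow₀ one_le_two))
    let U : Ω → (ℝ × ℝ) × ℝ := fun ω =>
      ((pathWeight d x F C K R γ n t i ω, eulerScheme d x R γ n t i ω), R (gridTime n t i) ω)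
    let G : Ω → ℝ := fun ω => γ (gridTime n t (i + 1)) ω - γ (gridTime n t i) ω
    have hU : Measurable[𝓕 (gridTime n t i)] U :=
      (hF.measurable_pathWeight_eulerScheme hγ.adapted hR d x K n t hi'.le).prodMk
        (hR _).measurable
    have hU' : Measurable U := hU.mono (𝓕.le _) le_rfl
    have hG : HasLaw G (gaussianReal 0 v) P := by
      have := hγ.hasLaw_sub (gridTime n t (i + 1)) (gridTime n t i)
      have e : nndist (gridTime n t (i + 1)).1 (gridTime n t i).1 = v := by
        ext
        rw [hv, coe_gridStep, coe_nndist, Real.dist_eq, abs_of_nonneg]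
        · rfl
        · exact sub_nonneg.2 (by exact_mod_cast hlt.le)
      rw [e] at this
      exact this
    have hind : IndepFun U G P := by
      have := hγ.indep _ _ hlt.le
      exact indep_of_indep_of_le_left this hU.comap_le
    let φ : ((ℝ × ℝ) × ℝ) × ℝ → ENNReal := fun q =>
      ENNReal.ofReal (F (q.1.1.2 + (2 * q.1.2 * q.2 + d * v)) *
        (q.1.1.1 * stepWeight d F C K v q.1.1.2 q.1.2))
    have hφ : Measurable φ := by
      have h1 := (hF.measurable_stepWeight d K v).comp
        (f := fun q : ((ℝ × ℝ) × ℝ) × ℝ => (q.1.1.2, q.1.2)) (by fun_prop)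
      have h2 : Measurable fun q : ((ℝ × ℝ) × ℝ) × ℝ =>
          F (q.1.1.2 + (2 * q.1.2 * q.2 + d * v)) := by
        have := hF.contDiff.continuous
        fun_prop
      have h3 : Measurable fun q : ((ℝ × ℝ) × ℝ) × ℝ => q.1.1.1 := by fun_prop
      exact (h2.mul (h3.mul h1)).ennreal_ofReal
    calc ∫⁻ ω, ENNReal.ofReal (F (eulerScheme d x R γ n t (i + 1) ω) *
          pathWeight d x F C K R γ n t (i + 1) ω) ∂P
        = ∫⁻ ω, φ (U ω, G ω) ∂P := by
          refine lintegral_congr fun ω => ?_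
          simp [φ, U, G, eulerScheme_succ d x R γ hi', pathWeight, Finset.prod_range_succ, v]
      _ = ∫⁻ q, φ q ∂((P.map U).prod (gaussianReal 0 v)) := by
          rw [← hG.map_eq, ← (indepFun_iff_map_prod_eq_prod_map_map hU'.aemeasurable
            hG.aemeasurable).1 hind, lintegral_map' hφ.aemeasurable
            (hU'.aemeasurable.prodMk hG.aemeasurable)]
      _ = ∫⁻ ω, ∫⁻ g, φ (U ω, g) ∂gaussianReal 0 v ∂P := by
          rw [lintegral_prod _ hφ.aemeasurable, lintegral_map hφ.lintegral_prod_right' hU']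
      _ ≤ _ := lintegral_mono fun ω =>
          hF.lintegral_step_mul_stepWeight_le hd K hv0 hv1 _ _ _

end BrownianPotential

/-! ### Convergence of the Euler scheme -/

namespace BrownianPotential

variable {Ω : Type*}

theorem measurable_itoSum [MeasurableSpace Ω] {H γ : ℝ≥0 → Ω → ℝ} (hH : ∀ t, Measurable (H t))
    (hγ : ∀ t, Measurable (γ t)) (hγc : ∀ ω, Continuous fun t => γ t ω) (n : ℕ) :
    Measurable fun q : Ω × ℝ => itoSum H γ n q.2.toNNReal q.1 := by
  have hγ' : Measurable (Function.uncurry γ) :=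
    measurable_uncurry_of_continuous_of_measurable hγc hγ
  have ht : Measurable fun q : Ω × ℝ => q.2.toNNReal := measurable_real_toNNReal.comp measurable_snd
  have hf : Measurable fun q : ℕ × (Ω × ℝ) => ∑ i ∈ Finset.range q.1, H ((i : ℝ≥0) / 2 ^ n) q.2.1 *
      (γ (min (((i : ℝ≥0) + 1) / 2 ^ n) q.2.2.toNNReal) q.2.1 - γ ((i : ℝ≥0) / 2 ^ n) q.2.1) := by
    refine measurable_from_prod_countable_right fun m => ?_
    refine Finset.measurable_sum (f := fun (i : ℕ) (q : Ω × ℝ) => H ((i : ℝ≥0) / 2 ^ n) q.1 *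
      (γ (min (((i : ℝ≥0) + 1) / 2 ^ n) q.2.toNNReal) q.1 - γ ((i : ℝ≥0) / 2 ^ n) q.1))
      (Finset.range m) fun i _ => ?_
    refine ((hH _).comp measurable_fst).mul (Measurable.sub ?_ ((hγ _).comp measurable_fst))
    exact hγ'.comp ((measurable_const.min ht).prodMk measurable_fst)
  have hc : Measurable fun q : Ω × ℝ => ⌈q.2.toNNReal * 2 ^ n⌉₊ :=
    Nat.measurable_ceil.comp (ht.mul_const _)
  have := hf.comp (hc.prodMk measurable_id)
  unfold itoSum
  exact this

/-- Convergence in probability of the left-endpoint sums at every time gives almost sure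
convergence, along a subsequence, at a fixed time and at almost every earlier time. -/
theorem exists_subseq_tendsto_itoSum [MeasurableSpace Ω] {P : Measure Ω} [IsProbabilityMeasure P]
    {H γ I : ℝ≥0 → Ω → ℝ} (hH : ∀ t, Measurable (H t)) (hγ : ∀ t, Measurable (γ t))
    (hγc : ∀ ω, Continuous fun t => γ t ω) (hI : ∀ t, Measurable (I t))
    (hIc : ∀ ω, Continuous fun t => I t ω) (h : IsItoIntegral H γ I P) (t : ℝ≥0) :
    ∃ ns : ℕ → ℕ, StrictMono ns ∧ ∀ᵐ ω ∂P,
      Tendsto (fun k => itoSum H γ (ns k) t ω) atTop (nhds (I t ω)) ∧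
      ∀ᵐ s ∂(volume.restrict (Set.Ioc 0 (t : ℝ))),
        Tendsto (fun k => itoSum H γ (ns k) s.toNNReal ω) atTop (nhds (I s.toNNReal ω)) := by
  set ν : Measure ℝ := volume.restrict (Set.Ioc 0 (t : ℝ)) with hν
  let f : ℕ → Ω × ℝ → ℝ := fun n q => itoSum H γ n q.2.toNNReal q.1
  let g : Ω × ℝ → ℝ := fun q => I q.2.toNNReal q.1
  have hq : Measurable fun q : Ω × ℝ => (q.1, q.2.toNNReal) :=
    measurable_fst.prodMk (measurable_real_toNNReal.comp measurable_snd)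
  have hf : ∀ n, Measurable (f n) := fun n => measurable_itoSum hH hγ hγc n
  have hg : Measurable g :=
    (measurable_uncurry_of_continuous_of_measurable hIc hI).comp (measurable_swap.comp hq)
  have hfg : TendstoInMeasure (P.prod ν) f atTop g := by
    intro ε hε
    have hS : ∀ n, MeasurableSet {q | ε ≤ edist (f n q) (g q)} := fun n =>
      measurableSet_le measurable_const ((hf n).edist hg)
    have e : ∀ n, (P.prod ν) {q | ε ≤ edist (f n q) (g q)} =
        ∫⁻ s, P ((fun ω => (ω, s)) ⁻¹' {q | ε ≤ edist (f n q) (g q)}) ∂ν := fun n =>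
      Measure.prod_apply_symm (hS n)
    rw [tendsto_congr e]
    have := tendsto_lintegral_of_dominated_convergence (μ := ν)
      (F := fun n s => P ((fun ω => (ω, s)) ⁻¹' {q | ε ≤ edist (f n q) (g q)})) (f := fun _ => 0)
      (fun _ => 1) (fun n => measurable_measure_prodMk_right (hS n))
      (fun n => ae_of_all _ fun s => prob_le_one) (by simp [hν])
      (ae_of_all _ fun s => h s.toNNReal ε hε)
    rwa [lintegral_zero] at this
  obtain ⟨ns, hns, hae⟩ := hfg.exists_seq_tendsto_ae
  obtain ⟨ms, hms, hae'⟩ := ((h t).comp hns.tendsto_atTop).exists_seq_tendsto_ae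
  refine ⟨ns ∘ ms, hns.comp hms, ?_⟩
  filter_upwards [hae', Measure.ae_ae_of_ae_prod hae] with ω h1 h2
  refine ⟨h1, ?_⟩
  filter_upwards [h2] with s hs
  exact hs.comp hms.tendsto_atTop

theorem floor_div_le (s : ℝ≥0) (n : ℕ) : (⌊s * 2 ^ n⌋₊ : ℝ≥0) / 2 ^ n ≤ s := by
  rw [div_le_iff₀ (by positivity)]
  exact Nat.floor_le (by positivity)

theorem tendsto_floor_div (s : ℝ≥0) :
    Tendsto (fun n : ℕ => (⌊s * 2 ^ n⌋₊ : ℝ≥0) / 2 ^ n) atTop (nhds s) := by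
  rw [← NNReal.tendsto_coe]
  have h := (tendsto_nat_floor_mul_div_atTop (R := ℝ) s.coe_nonneg).comp
    (tendsto_pow_atTop_atTop_of_one_lt (one_lt_two (α := ℝ)))
  refine h.congr fun n => ?_
  have e : ⌊(s : ℝ) * 2 ^ n⌋₊ = ⌊s * 2 ^ n⌋₊ := by
    refine (Nat.floor_eq_iff (by positivity)).2 ⟨?_, ?_⟩
    · exact_mod_cast Nat.floor_le (a := s * 2 ^ n) (by positivity)
    · exact_mod_cast Nat.lt_floor_add_one (s * 2 ^ n)
  simp [e]

/-- The Euler scheme at the last grid point before `s`, in terms of the left-endpoint sum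
at `s`. -/
theorem eulerScheme_floor (d x : ℝ) (R γ : ℝ≥0 → Ω → ℝ) (n : ℕ) {s t : ℝ≥0} (hst : s ≤ t) (ω : Ω) :
    eulerScheme d x R γ n t ⌊s * 2 ^ n⌋₊ ω =
      x ^ 2 + d * ((⌊s * 2 ^ n⌋₊ : ℝ≥0) / 2 ^ n : ℝ≥0) + itoSum (fun u ω => 2 * R u ω) γ n s ω -
        2 * R ((⌊s * 2 ^ n⌋₊ : ℝ≥0) / 2 ^ n) ω *
          (γ s ω - γ ((⌊s * 2 ^ n⌋₊ : ℝ≥0) / 2 ^ n) ω) := by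
  set j := ⌊s * 2 ^ n⌋₊ with hj
  have hjs : (j : ℝ≥0) / 2 ^ n ≤ s := floor_div_le s n
  have hlt : ∀ i < j, ((i : ℝ≥0) + 1) / 2 ^ n ≤ s := fun i hi => by
    refine le_trans ?_ hjs
    gcongr
    exact_mod_cast hi
  have e1 : eulerScheme d x R γ n t j ω = x ^ 2 + d * ((j : ℝ≥0) / 2 ^ n : ℝ≥0) +
      ∑ i ∈ Finset.range j, 2 * R ((i : ℝ≥0) / 2 ^ n) ω *
        (γ (min (((i : ℝ≥0) + 1) / 2 ^ n) s) ω - γ ((i : ℝ≥0) / 2 ^ n) ω) := by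
    rw [eulerScheme, gridTime, min_eq_left (hjs.trans hst)]
    congr 1
    refine Finset.sum_congr rfl fun i hi => ?_
    have := hlt i (Finset.mem_range.1 hi)
    rw [min_eq_left this, min_eq_left (this.trans hst)]
  rw [e1]
  rcases eq_or_lt_of_le hjs with h | h
  · -- `s` is a grid point
    have hc : ⌈s * 2 ^ n⌉₊ = j := by
      have : s * 2 ^ n = (j : ℝ≥0) := by rw [← h]; field_simp
      rw [this, Nat.ceil_natCast]
    rw [itoSum, hc, h]
    ring
  · have hc : ⌈s * 2 ^ n⌉₊ = j + 1 := by
      rw [Nat.ceil_eq_iff (by omega)]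
      refine ⟨?_, ?_⟩
      · rw [Nat.add_sub_cancel]
        exact (div_lt_iff₀ (by positivity)).1 h
      · push_cast
        exact (Nat.lt_floor_add_one _).le
    have hs1 : s ≤ ((j : ℝ≥0) + 1) / 2 ^ n := by
      rw [le_div_iff₀ (by positivity)]
      exact (Nat.lt_floor_add_one _).le
    rw [itoSum, hc, Finset.sum_range_succ, min_eq_right hs1]
    ring

theorem eulerScheme_ceil (d x : ℝ) (R γ : ℝ≥0 → Ω → ℝ) (n : ℕ) (t : ℝ≥0) (ω : Ω) :
    eulerScheme d x R γ n t ⌈t * 2 ^ n⌉₊ ω =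
      x ^ 2 + d * t + itoSum (fun u ω => 2 * R u ω) γ n t ω := by
  rw [eulerScheme, gridTime_ceil, itoSum]

/-- A Riemann sum along the stopped dyadic grid is the integral of a step function. -/
theorem sum_mul_gridStep_eq_integral (h : ℕ → ℝ) (n : ℕ) (t : ℝ≥0) :
    ∑ j ∈ Finset.range ⌈t * 2 ^ n⌉₊, h j * gridStep n t j =
      ∫ s in (0 : ℝ)..t, h ⌊s.toNNReal * 2 ^ n⌋₊ := by
  have hpt : ∀ j < ⌈t * 2 ^ n⌉₊, ∀ s : ℝ, (gridTime n t j : ℝ) < s → s < gridTime n t (j + 1) →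
      h ⌊s.toNNReal * 2 ^ n⌋₊ = h j := by
    intro j hj s h1 h2
    have hs0 : 0 ≤ s := (gridTime n t j).coe_nonneg.trans h1.le
    rw [gridTime_of_lt_ceil hj] at h1
    lift s to ℝ≥0 using hs0
    rw [NNReal.coe_lt_coe] at h1 h2
    congr 1
    rw [Real.toNNReal_coe, Nat.floor_eq_iff (by positivity)]
    rw [div_lt_iff₀ (by positivity)] at h1
    refine ⟨h1.le, ?_⟩
    have := h2.trans_le (min_le_left _ _)
    rw [lt_div_iff₀ (by positivity)] at this
    exact_mod_cast this
  have hae : ∀ j < ⌈t * 2 ^ n⌉₊, ∀ᵐ s : ℝ,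
      s ∈ Set.uIoc (gridTime n t j : ℝ) (gridTime n t (j + 1)) → h j = h ⌊s.toNNReal * 2 ^ n⌋₊ := by
    intro j hj
    have hne : ∀ᵐ s : ℝ, s ≠ (gridTime n t (j + 1) : ℝ) := by
      simp [ae_iff]
    filter_upwards [hne] with s hs hmem
    rw [Set.uIoc_of_le (by exact_mod_cast (gridTime_mono n t j.le_succ))] at hmem
    exact (hpt j hj s hmem.1 (lt_of_le_of_ne hmem.2 hs)).symm
  have := intervalIntegral.sum_integral_adjacent_intervals (μ := volume)
    (a := fun k => (gridTime n t k : ℝ)) (n := ⌈t * 2 ^ n⌉₊)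
    (f := fun s => h ⌊s.toNNReal * 2 ^ n⌋₊) (fun j hj => by
      refine (intervalIntegrable_const (c := h j)).congr_ae ?_
      exact (ae_restrict_iff' measurableSet_uIoc).2 (hae j hj))
  simp only [gridTime_ceil] at this
  rw [show gridTime n t 0 = 0 by simp [gridTime], NNReal.coe_zero] at this
  rw [← this]
  refine Finset.sum_congr rfl fun j hj => ?_
  rw [← intervalIntegral.integral_congr_ae (hae j (Finset.mem_range.1 hj)),
    intervalIntegral.integral_const, smul_eq_mul, coe_gridStep, mul_comm]

theorem IsTestFunction.abs_growthRate_le {F : ℝ → ℝ} {C : ℝ} (hF : IsTestFunction F C) {d K : ℝ}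
    (hd : 0 ≤ d) (z : ℝ) {ρ : ℝ} (hρ : ρ ∈ Set.Icc 0 K) :
    |growthRate d F z ρ| ≤ C * (d * C + 2 * K ^ 2 * C) := by
  have hC := hF.const_nonneg
  have h1 : (F z)⁻¹ ≤ C := by
    rw [inv_le_iff_one_le_mul₀ (hF.pos z)]
    exact hF.one_le z
  have h2 : ρ ^ 2 ≤ K ^ 2 := pow_le_pow_left₀ hρ.1 hρ.2 2
  rw [growthRate, div_eq_inv_mul, abs_mul, abs_of_pos (inv_pos.2 (hF.pos z))]
  refine mul_le_mul h1 ((abs_add_le _ _).trans ?_) (abs_nonneg _) hC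
  rw [abs_mul, abs_mul, abs_of_nonneg hd, abs_of_nonneg (by positivity : 0 ≤ 2 * ρ ^ 2)]
  have := hF.deriv_le z
  have := hF.deriv_two_le z
  gcongr

theorem IsTestFunction.tendsto_growthRate {F : ℝ → ℝ} {C : ℝ} (hF : IsTestFunction F C) (d : ℝ)
    {z ρ : ℕ → ℝ} {z₀ ρ₀ : ℝ} (hz : Tendsto z atTop (nhds z₀)) (hρ : Tendsto ρ atTop (nhds ρ₀)) :
    Tendsto (fun k => growthRate d F (z k) (ρ k)) atTop (nhds (growthRate d F z₀ ρ₀)) := by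
  have h := (hF.continuous_growthRate d).tendsto (z₀, ρ₀)
  have h' := Tendsto.comp h (hz.prodMk_nhds hρ)
  simpa only [Function.comp_def] using h'

/-- Convergence of the path weights along a path on which the left-endpoint sums converge. -/
theorem IsTestFunction.tendsto_pathWeight {F : ℝ → ℝ} {C : ℝ} (hF : IsTestFunction F C) {d : ℝ}
    (hd : 0 ≤ d) {x K : ℝ} {R γ : ℝ≥0 → Ω → ℝ} {ω : Ω} (hR : Continuous fun t => R t ω)
    (hγ : Continuous fun t => γ t ω) {t : ℝ≥0} (hRK : ∀ s ≤ t, R s ω ∈ Set.Icc 0 K)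
    {ns : ℕ → ℕ} (hns : StrictMono ns)
    (h : ∀ᵐ s ∂(volume.restrict (Set.Ioc 0 (t : ℝ))),
      Tendsto (fun k => itoSum (fun u ω => 2 * R u ω) γ (ns k) s.toNNReal ω) atTop
        (nhds (R s.toNNReal ω ^ 2 - x ^ 2 - d * (s.toNNReal : ℝ)))) :
    Tendsto (fun k => pathWeight d x F C K R γ (ns k) t ⌈t * 2 ^ ns k⌉₊ ω) atTop
      (nhds (Real.exp (-∫ s in (0 : ℝ)..t,
        growthRate d F (R s.toNNReal ω ^ 2) (R s.toNNReal ω)))) := by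
  set D : ℝ := C ^ 2 * (d ^ 2 + 128 * K ^ 3 + d ^ 3) with hD
  have ht0 : (0 : ℝ) ≤ t := t.coe_nonneg
  let G : ℕ → ℕ → ℝ := fun n j =>
    growthRate d F (eulerScheme d x R γ n t j ω) (R (gridTime n t j) ω)
  have hprod : ∀ n, pathWeight d x F C K R γ n t ⌈t * 2 ^ n⌉₊ ω =
      Real.exp (-((∫ s in (0 : ℝ)..t, G n ⌊s.toNNReal * 2 ^ n⌋₊) +
        D * ∑ j ∈ Finset.range ⌈t * 2 ^ n⌉₊, (gridStep n t j : ℝ) * √(gridStep n t j))) := by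
    intro n
    rw [← sum_mul_gridStep_eq_integral, Finset.mul_sum, ← Finset.sum_add_distrib,
      ← Finset.sum_neg_distrib, Real.exp_sum, pathWeight]
    refine Finset.prod_congr rfl fun j _ => ?_
    rw [stepWeight, Set.indicator_of_mem (hRK (gridTime n t j) (min_le_right _ _))]
  have herr : Tendsto (fun n : ℕ => ∑ j ∈ Finset.range ⌈t * 2 ^ n⌉₊,
      (gridStep n t j : ℝ) * √(gridStep n t j)) atTop (nhds 0) := by
    have hb : Tendsto (fun n : ℕ => (t : ℝ) * √((2 ^ n)⁻¹ : ℝ)) atTop (nhds 0) := by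
      have h1 : Tendsto (fun n : ℕ => ((2 ^ n)⁻¹ : ℝ)) atTop (nhds 0) :=
        (tendsto_pow_atTop_atTop_of_one_lt (one_lt_two (α := ℝ))).inv_tendsto_atTop
      simpa using (h1.sqrt).const_mul (t : ℝ)
    refine squeeze_zero (fun n => Finset.sum_nonneg fun j _ => by positivity) (fun n => ?_) hb
    calc ∑ j ∈ Finset.range ⌈t * 2 ^ n⌉₊, (gridStep n t j : ℝ) * √(gridStep n t j)
        ≤ ∑ j ∈ Finset.range ⌈t * 2 ^ n⌉₊, √((2 ^ n)⁻¹ : ℝ) * (gridStep n t j : ℝ) := by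
          refine Finset.sum_le_sum fun j _ => ?_
          rw [mul_comm]
          gcongr
          exact_mod_cast gridStep_le n t j
      _ = √((2 ^ n)⁻¹ : ℝ) * t := by
          have := sum_mul_gridStep_eq_integral (fun _ => 1) n t
          simp only [one_mul, intervalIntegral.integral_const, smul_eq_mul, mul_one,
            sub_zero] at this
          rw [← Finset.mul_sum, this]
      _ = _ := mul_comm _ _
  have hint : Tendsto (fun k => ∫ s in (0 : ℝ)..t, G (ns k) ⌊s.toNNReal * 2 ^ ns k⌋₊) atTop
      (nhds (∫ s in (0 : ℝ)..t, growthRate d F (R s.toNNReal ω ^ 2) (R s.toNNReal ω))) := by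
    refine intervalIntegral.tendsto_integral_filter_of_dominated_convergence
      (fun _ => C * (d * C + 2 * K ^ 2 * C)) (Eventually.of_forall fun k => ?_)
      (Eventually.of_forall fun k => ae_of_all _ fun s _ => ?_) (by simp) ?_
    · have h1 : Measurable fun s : ℝ => ⌊s.toNNReal * 2 ^ ns k⌋₊ :=
        Nat.measurable_floor.comp (measurable_real_toNNReal.mul_const _)
      exact ((measurable_from_nat (f := G (ns k))).comp h1).aestronglyMeasurable
    · exact hF.abs_growthRate_le hd _ (hRK _ (min_le_right _ _))
    · rw [Set.uIoc_of_le ht0]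
      refine (ae_restrict_iff' measurableSet_Ioc).1 ?_
      filter_upwards [h, ae_restrict_mem measurableSet_Ioc] with s hs hst
      set u := s.toNNReal with hu
      have hut : u ≤ t := by rw [hu]; exact Real.toNNReal_le_iff_le_coe.2 hst.2
      have hfl : Tendsto (fun k => (⌊u * 2 ^ ns k⌋₊ : ℝ≥0) / 2 ^ ns k) atTop (nhds u) :=
        (tendsto_floor_div u).comp hns.tendsto_atTop
      have hRl : Tendsto (fun k => R ((⌊u * 2 ^ ns k⌋₊ : ℝ≥0) / 2 ^ ns k) ω) atTop (nhds (R u ω)) :=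
        (hR.tendsto u).comp hfl
      have hγl : Tendsto (fun k => γ ((⌊u * 2 ^ ns k⌋₊ : ℝ≥0) / 2 ^ ns k) ω) atTop (nhds (γ u ω)) :=
        (hγ.tendsto u).comp hfl
      have hcl : Tendsto (fun k => (((⌊u * 2 ^ ns k⌋₊ : ℝ≥0) / 2 ^ ns k : ℝ≥0) : ℝ)) atTop
          (nhds (u : ℝ)) := (NNReal.tendsto_coe.2 hfl)
      have hZ : Tendsto (fun k => eulerScheme d x R γ (ns k) t ⌊u * 2 ^ ns k⌋₊ ω) atTop
          (nhds (R u ω ^ 2)) := by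
        simp_rw [eulerScheme_floor d x R γ _ hut]
        have := (((hcl.const_mul d).const_add (x ^ 2)).add hs).sub
          ((hRl.const_mul 2).mul (hγl.const_sub (γ u ω)))
        convert this using 2
        ring
      have hR' : Tendsto (fun k => R (gridTime (ns k) t ⌊u * 2 ^ ns k⌋₊) ω) atTop
          (nhds (R u ω)) := by
        refine hRl.congr fun k => ?_
        rw [gridTime, min_eq_left ((floor_div_le u _).trans hut)]
      exact hF.tendsto_growthRate d hZ hR'
  simp_rw [hprod]
  have := (hint.add ((herr.comp hns.tendsto_atTop).const_mul D)).neg.rexp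
  simpa using this

end BrownianPotential

/-! ### The exponential functional inequality for Bessel processes -/

namespace BrownianPotential

variable {Ω : Type*}

/-- The relative growth rate of `z ↦ (z + ε) ^ p` under the generator `2 z ∂² + d ∂` of the squared
Bessel process of dimension `d`. -/
noncomputable def besselRate (d ε p z : ℝ) : ℝ :=
  p * d / (z + ε) + 2 * p * (p - 1) * z / (z + ε) ^ 2

theorem growthRate_eq_besselRate {d ε p : ℝ} (hε : 0 < ε) {F : ℝ → ℝ} {ρ : ℝ}
    (h0 : F (ρ ^ 2) = (ρ ^ 2 + ε) ^ p)
    (h1 : iteratedDeriv 1 F (ρ ^ 2) = p * (ρ ^ 2 + ε) ^ (p - 1))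
    (h2 : iteratedDeriv 2 F (ρ ^ 2) = p * (p - 1) * (ρ ^ 2 + ε) ^ (p - 2)) :
    growthRate d F (ρ ^ 2) ρ = besselRate d ε p (ρ ^ 2) := by
  have hz : 0 < ρ ^ 2 + ε := by positivity
  have hp : (ρ ^ 2 + ε) ^ p ≠ 0 := (Real.rpow_pos_of_pos hz p).ne'
  rw [growthRate, besselRate, h0, h1, h2, Real.rpow_sub hz, Real.rpow_sub hz, Real.rpow_one,
    Real.rpow_two]
  field_simp

variable [MeasurableSpace Ω] {P : Measure Ω} [IsProbabilityMeasure P]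

/-- A Bessel process has a version `Y` with continuous paths and measurable marginals for which
`(Y² + ε)ᵖ exp (-∫ besselRate)` has expectation at most its initial value. The process inside the
expectation is a positive local martingale; only the resulting inequality is needed. -/
theorem IsBessel.exists_version_lintegral_le {d x : ℝ} (hd : 0 ≤ d) (hx : 0 ≤ x)
    {R : ℝ≥0 → Ω → ℝ} (hR : IsBessel d x R P) :
    ∃ Y : ℝ≥0 → Ω → ℝ, (∀ t, Measurable (Y t)) ∧ (∀ ω, Continuous fun t => Y t ω) ∧
      (∀ t ω, 0 ≤ Y t ω) ∧ (∀ᵐ ω ∂P, ∀ t, Y t ω = R t ω) ∧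
      ∀ ε : ℝ, 0 < ε → ∀ (p : ℝ) (t : ℝ≥0),
        ∫⁻ ω, ENNReal.ofReal ((Y t ω ^ 2 + ε) ^ p *
          Real.exp (-∫ s in (0 : ℝ)..t, besselRate d ε p (Y s.toNNReal ω ^ 2))) ∂P ≤
        ENNReal.ofReal ((x ^ 2 + ε) ^ p) := by
  obtain ⟨𝓕, γ, hγ, hRad, hRc, hR0, -, hIto⟩ := hR
  obtain ⟨Y₀, hY₀m, hY₀c, hY₀⟩ := exists_continuous_modification
    (fun t => ((hRad t).measurable.mono (𝓕.le t) le_rfl).aemeasurable) hRc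
  obtain ⟨g, hgm, hgc, hg⟩ := exists_continuous_modification (fun t => hγ.aemeasurable t) hγ.cont
  set Y : ℝ≥0 → Ω → ℝ := fun t ω => |Y₀ t ω| with hYdef
  have hYm : ∀ t, Measurable (Y t) := fun t => (hY₀m t).abs
  have hYc : ∀ ω, Continuous fun t => Y t ω := fun ω => (hY₀c ω).abs
  have hY : ∀ᵐ ω ∂P, ∀ t, Y t ω = R t ω := by
    filter_upwards [hY₀, hR0] with ω h1 h2 t
    rw [hYdef]
    simp only [h1, abs_of_nonneg (h2 t)]
  refine ⟨Y, hYm, hYc, fun t ω => abs_nonneg _, hY, fun ε hε p t => ?_⟩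
  have hIto' : IsItoIntegral (fun t ω => 2 * Y t ω) g (fun t ω => Y t ω ^ 2 - x ^ 2 - d * (t : ℝ))
      P := by
    intro s
    refine (hIto s).congr' (Eventually.of_forall fun n => ?_) ?_
    · filter_upwards [hY, hg] with ω h1 h2
      simp only [itoSum, h1, h2]
    · filter_upwards [hY] with ω h1
      simp only [h1]
  obtain ⟨ns, hns, hlim⟩ := exists_subseq_tendsto_itoSum (fun t => (hYm t).const_mul 2) hgm hgc
    (fun t => (((hYm t).pow_const 2).sub_const _).sub_const _)
    (fun ω => by have := hYc ω; fun_prop) hIto' t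
  -- test functions equal to the power function on larger and larger intervals
  have hK : ∀ k : ℕ, 0 ≤ x + k := fun k => by positivity
  choose F C hF hFeq using fun k : ℕ => exists_isTestFunction_eq_rpow hε p (sq_nonneg (x + k))
  let Φ : ℕ → ℕ → Ω → ENNReal := fun k n ω =>
    ENNReal.ofReal (F k (eulerScheme d x R γ (ns n) t ⌈t * 2 ^ ns n⌉₊ ω) *
      pathWeight d x (F k) (C k) (x + k) R γ (ns n) t ⌈t * 2 ^ ns n⌉₊ ω)
  have hΦm : ∀ k n, Measurable (Φ k n) := by
    intro k n
    have h := ((hF k).measurable_pathWeight_eulerScheme hγ.adapted hRad d x (x + k) (ns n) t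
      le_rfl).mono (𝓕.le _) le_rfl
    have h2 := (hF k).contDiff.continuous.measurable.comp (measurable_snd.comp h)
    exact (h2.mul (measurable_fst.comp h)).ennreal_ofReal
  have hΦle : ∀ k n, ∫⁻ ω, Φ k n ω ∂P ≤ ENNReal.ofReal ((x ^ 2 + ε) ^ p) := by
    intro k n
    have := (hF k).lintegral_pathWeight_le hγ hRad hd x (x + k) (ns n) t le_rfl
    rwa [(hFeq k (x ^ 2) ⟨sq_nonneg _, by gcongr; simp⟩).1] at this
  set Ψ : Ω → ENNReal := fun ω => ENNReal.ofReal ((Y t ω ^ 2 + ε) ^ p *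
          Real.exp (-∫ s in (0 : ℝ)..t, besselRate d ε p (Y s.toNNReal ω ^ 2))) with hΨ
  have hconv : ∀ᵐ ω ∂P, ∀ᶠ k in atTop, Tendsto (fun n => Φ k n ω) atTop (nhds (Ψ ω)) := by
    filter_upwards [hY, hg, hlim, hR0] with ω h1 h2 h3 h4
    have e1 : ∀ s, R s ω = Y s ω := fun s => (h1 s).symm
    have hRcω : Continuous fun s => R s ω := by simp_rw [e1]; exact hYc ω
    have hγcω : Continuous fun s => γ s ω := by simp_rw [← h2]; exact hgc ω
    have e3 : ∀ n s, itoSum (fun t ω => 2 * R t ω) γ n s ω =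
        itoSum (fun t ω => 2 * Y t ω) g n s ω :=
      fun n s => by simp only [itoSum, h1, h2]
    obtain ⟨M, hM⟩ := (isCompact_Icc (a := (0 : ℝ≥0)) (b := t)).exists_bound_of_continuousOn
      hRcω.continuousOn
    obtain ⟨k₀, hk₀⟩ := exists_nat_ge M
    filter_upwards [eventually_ge_atTop k₀] with k hk
    have hRK : ∀ s ≤ t, R s ω ∈ Set.Icc 0 (x + k) := fun s hs => ⟨h4 s, by
      have := hM s ⟨zero_le, hs⟩
      have hkk : (k₀ : ℝ) ≤ k := by exact_mod_cast hk
      rw [Real.norm_eq_abs] at this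
      linarith [le_abs_self (R s ω)]⟩
    have hXK : ∀ s ≤ t, R s ω ^ 2 ∈ Set.Icc 0 ((x + k) ^ 2) := fun s hs =>
      ⟨sq_nonneg _, pow_le_pow_left₀ (hRK s hs).1 (hRK s hs).2 2⟩
    have hw := (hF k).tendsto_pathWeight hd (x := x) hRcω hγcω hRK hns (by
      simp_rw [e3, e1]; exact h3.2)
    have hZ : Tendsto (fun n => eulerScheme d x R γ (ns n) t ⌈t * 2 ^ ns n⌉₊ ω) atTop
        (nhds (R t ω ^ 2)) := by
      simp_rw [eulerScheme_ceil, e3, e1]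
      have := h3.1.const_add (x ^ 2 + d * t)
      convert this using 2
      ring
    have hFZ := ((hF k).contDiff.continuous.tendsto (R t ω ^ 2)).comp hZ
    have hlimit := ENNReal.tendsto_ofReal (hFZ.mul hw)
    have eint : ∫ s in (0 : ℝ)..t, growthRate d (F k) (R s.toNNReal ω ^ 2) (R s.toNNReal ω) =
        ∫ s in (0 : ℝ)..t, besselRate d ε p (Y s.toNNReal ω ^ 2) := by
      refine intervalIntegral.integral_congr fun s hs => ?_
      rw [Set.uIcc_of_le t.coe_nonneg] at hs
      have hst : s.toNNReal ≤ t := Real.toNNReal_le_iff_le_coe.2 hs.2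
      obtain ⟨a1, a2, a3⟩ := hFeq k _ (hXK _ hst)
      rw [growthRate_eq_besselRate hε a1 a2 a3, e1]
    rw [eint, (hFeq k _ (hXK t le_rfl)).1, e1] at hlimit
    exact hlimit
  have hliminf : ∀ᵐ ω ∂P, Ψ ω = liminf (fun k => liminf (fun n => Φ k n ω) atTop) atTop := by
    filter_upwards [hconv] with ω hω
    have : Tendsto (fun k => liminf (fun n => Φ k n ω) atTop) atTop (nhds (Ψ ω)) := by
      refine tendsto_const_nhds.congr' ?_
      filter_upwards [hω] with k hk using hk.liminf_eq.symm
    exact this.liminf_eq.symm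
  have hb : ∀ k, ∫⁻ ω, liminf (fun n => Φ k n ω) atTop ∂P ≤ ENNReal.ofReal ((x ^ 2 + ε) ^ p) := by
    intro k
    refine (lintegral_liminf_le (hΦm k)).trans ?_
    exact liminf_le_of_le (by isBoundedDefault) fun b hb => by
      obtain ⟨n, hn⟩ := hb.exists
      exact hn.trans (hΦle k n)
  calc ∫⁻ ω, Ψ ω ∂P = ∫⁻ ω, liminf (fun k => liminf (fun n => Φ k n ω) atTop) atTop ∂P :=
        lintegral_congr_ae hliminf
    _ ≤ liminf (fun k => ∫⁻ ω, liminf (fun n => Φ k n ω) atTop ∂P) atTop :=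
        lintegral_liminf_le fun k => Measurable.liminf (hΦm k)
    _ ≤ _ := liminf_le_of_le (by isBoundedDefault) fun b hb' => by
        obtain ⟨k, hk⟩ := hb'.exists
        exact hk.trans (hb k)

end BrownianPotential

/-! ### Tail estimates for the integral of the inverse squared Bessel process -/

namespace BrownianPotential

variable {Ω : Type*} [MeasurableSpace Ω]

/-- A continuous nonnegative process which satisfies the exponential functional inequality of the
squared Bessel process of dimension `d` started at `z`. -/
structure HasBesselMoments (d z : ℝ) (X : ℝ → Ω → ℝ) (P : Measure Ω) : Prop where
  measurable : ∀ t, Measurable (X t)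
  continuous : ∀ ω, Continuous fun t => X t ω
  nonneg : ∀ t ω, 0 ≤ X t ω
  lintegral_le : ∀ ε : ℝ, 0 < ε → ∀ p t : ℝ, 0 ≤ t →
    ∫⁻ ω, ENNReal.ofReal ((X t ω + ε) ^ p *
      Real.exp (-∫ s in (0 : ℝ)..t, besselRate d ε p (X s ω))) ∂P ≤ ENNReal.ofReal ((z + ε) ^ p)

/-- The integral `∫₀ᵗ ds / x s`, with the convention `1 / 0 = ∞`. -/
noncomputable def inverseClock (x : ℝ → ℝ) (t : ℝ) : ENNReal :=
  ∫⁻ s in Set.Ioc 0 t, (ENNReal.ofReal (x s))⁻¹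

theorem inverseClock_mono (x : ℝ → ℝ) : Monotone (inverseClock x) := fun _ _ h =>
  lintegral_mono_set (Set.Ioc_subset_Ioc_right h)

theorem ae_pos_of_inverseClock_lt_top {x : ℝ → ℝ} (hx : Continuous x) {t : ℝ}
    (h : inverseClock x t < ⊤) : ∀ᵐ s ∂(volume.restrict (Set.Ioc 0 t)), 0 < x s := by
  have hm : Measurable fun s => (ENNReal.ofReal (x s))⁻¹ := by
    have := hx.measurable
    fun_prop
  filter_upwards [ae_lt_top hm h.ne] with s hs
  rw [ENNReal.inv_lt_top] at hs
  exact ENNReal.ofReal_pos.1 hs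

/-- If the clock with `1 / 0 = ∞` is finite then it is the Bochner integral of `1 / x`. -/
theorem integrable_inv_of_inverseClock_lt_top {x : ℝ → ℝ} (hx : Continuous x) {t : ℝ} (ht : 0 ≤ t)
    (h : inverseClock x t < ⊤) :
    IntervalIntegrable (fun s => 1 / x s) volume 0 t ∧
      ENNReal.ofReal (∫ s in (0 : ℝ)..t, 1 / x s) = inverseClock x t := by
  have hpos := ae_pos_of_inverseClock_lt_top hx h
  have hm : AEStronglyMeasurable (fun s => 1 / x s) (volume.restrict (Set.Ioc 0 t)) := by
    have := hx.measurable
    exact Measurable.aestronglyMeasurable (by fun_prop)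
  have e : ∫⁻ s in Set.Ioc 0 t, ENNReal.ofReal (1 / x s) = inverseClock x t := by
    refine lintegral_congr_ae ?_
    filter_upwards [hpos] with s hs
    rw [one_div, ENNReal.ofReal_inv_of_pos hs]
  have hnn : ∀ᵐ s ∂(volume.restrict (Set.Ioc 0 t)), 0 ≤ 1 / x s := by
    filter_upwards [hpos] with s hs
    positivity
  have hi : IntegrableOn (fun s => 1 / x s) (Set.Ioc 0 t) := by
    refine ⟨hm, ?_⟩
    rw [hasFiniteIntegral_iff_ofReal hnn, e]
    exact h
  refine ⟨(intervalIntegrable_iff_integrableOn_Ioc_of_le ht).2 hi, ?_⟩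
  rw [intervalIntegral.integral_of_le ht, ofReal_integral_eq_lintegral_ofReal hi hnn, e]

/-- The clock is the limit of the regularised clocks. -/
theorem tendsto_integral_inv_add {x : ℝ → ℝ} (hx : Continuous x) (hx0 : ∀ s, 0 ≤ x s) {t : ℝ}
    (ht : 0 ≤ t) :
    Tendsto (fun n : ℕ => ENNReal.ofReal (∫ s in (0 : ℝ)..t, 1 / (x s + 1 / ((n : ℝ) + 1)))) atTop
      (nhds (inverseClock x t)) := by
  have hε : ∀ n : ℕ, (0 : ℝ) < 1 / ((n : ℝ) + 1) := fun n => Nat.one_div_pos_of_nat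
  have e : ∀ n : ℕ, ENNReal.ofReal (∫ s in (0 : ℝ)..t, 1 / (x s + 1 / ((n : ℝ) + 1))) =
      ∫⁻ s in Set.Ioc 0 t, (ENNReal.ofReal (x s + 1 / ((n : ℝ) + 1)))⁻¹ := by
    intro n
    have hpos : ∀ s, 0 < x s + 1 / ((n : ℝ) + 1) := fun s => by linarith [hx0 s, hε n]
    have hc : Continuous fun s => 1 / (x s + 1 / ((n : ℝ) + 1)) :=
      continuous_const.div (by fun_prop) fun s => (hpos s).ne'
    rw [intervalIntegral.integral_of_le ht, ofReal_integral_eq_lintegral_ofReal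
      (hc.integrableOn_Icc.mono_set Set.Ioc_subset_Icc_self)
      (ae_of_all _ fun s => (one_div_pos.2 (hpos s)).le)]
    refine lintegral_congr fun s => ?_
    rw [one_div (x s + _), ENNReal.ofReal_inv_of_pos (hpos s)]
  simp_rw [e]
  have hxm := hx.measurable
  refine lintegral_tendsto_of_tendsto_of_monotone (fun n => Measurable.aemeasurable (by fun_prop))
    (ae_of_all _ fun s n m hnm => ?_) (ae_of_all _ fun s => ?_)
  · refine ENNReal.inv_le_inv.2 (ENNReal.ofReal_le_ofReal ?_)
    have := Nat.one_div_le_one_div (α := ℝ) hnm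
    linarith
  · refine (continuous_inv.tendsto _).comp (ENNReal.tendsto_ofReal ?_)
    simpa using (tendsto_one_div_add_atTop_nhds_zero_nat (𝕜 := ℝ)).const_add (x s)

namespace HasBesselMoments

variable {P : Measure Ω} {X : ℝ → Ω → ℝ} {d z : ℝ}

theorem measurable_uncurry (hX : HasBesselMoments d z X P) :
    Measurable fun q : Ω × ℝ => X q.2 q.1 :=
  (measurable_uncurry_of_continuous_of_measurable hX.continuous hX.measurable).comp measurable_swap

theorem continuous_integrand (hX : HasBesselMoments d z X P) {ε : ℝ} (hε : 0 < ε) (ω : Ω) :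
    Continuous fun s => 1 / (X s ω + ε) := by
  have := hX.continuous ω
  exact continuous_const.div (by fun_prop) fun s => by linarith [hX.nonneg s ω]

theorem continuous_besselRate (hX : HasBesselMoments d z X P) {ε : ℝ} (hε : 0 < ε) (p : ℝ) (ω : Ω) :
    Continuous fun s => besselRate d ε p (X s ω) := by
  have := hX.continuous ω
  have h0 : ∀ s, X s ω + ε ≠ 0 := fun s => by linarith [hX.nonneg s ω]
  unfold besselRate
  exact (continuous_const.div (by fun_prop) h0).add
    (Continuous.div (by fun_prop) (by fun_prop) fun s => pow_ne_zero 2 (h0 s))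

theorem measurable_integral_besselRate (hX : HasBesselMoments d z X P) (ε p : ℝ) {t : ℝ}
    (ht : 0 ≤ t) : Measurable fun ω => ∫ s in (0 : ℝ)..t, besselRate d ε p (X s ω) := by
  simp_rw [intervalIntegral.integral_of_le ht]
  have h := hX.measurable_uncurry
  have : Measurable fun q : Ω × ℝ => besselRate d ε p (X q.2 q.1) := by
    unfold besselRate
    exact (measurable_const.div (h.add_const ε)).add
      ((h.const_mul _).div ((h.add_const ε).pow_const 2))
  exact (this.stronglyMeasurable.integral_prod_right'
    (ν := volume.restrict (Set.Ioc 0 t))).measurable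

theorem measurable_inverseClock (hX : HasBesselMoments d z X P) (t : ℝ) :
    Measurable fun ω => inverseClock (fun s => X s ω) t := by
  have h := hX.measurable_uncurry.ennreal_ofReal.inv
  exact h.lintegral_prod_right'

/-- The negative-power inequality: a large clock together with a moderate endpoint is unlikely. -/
theorem measure_le_and_lt_inverseClock_le (hX : HasBesselMoments d z X P) (hz : 0 < z) {θ : ℝ}
    (hθ : 0 < θ) (hθd : 2 * θ ≤ d - 2) {t T b : ℝ} (ht : 0 ≤ t) (hT : 0 ≤ T) (hb : 0 ≤ b) :
    P {ω | X t ω ≤ T ∧ ENNReal.ofReal b < inverseClock (fun s => X s ω) t} ≤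
      ENNReal.ofReal (z ^ (-θ) / ((T + 1) ^ (-θ) * Real.exp (θ * (d - 2 - 2 * θ) * b))) := by
  set B := z ^ (-θ) / ((T + 1) ^ (-θ) * Real.exp (θ * (d - 2 - 2 * θ) * b))
  let S : ℕ → Set Ω := fun n =>
    {ω | X t ω ≤ T ∧ b < ∫ s in (0 : ℝ)..t, 1 / (X s ω + 1 / ((n : ℝ) + 1))}
  have hε : ∀ n : ℕ, (0 : ℝ) < 1 / ((n : ℝ) + 1) := fun n => Nat.one_div_pos_of_nat
  have hc : 0 ≤ θ * (d - 2 - 2 * θ) := mul_nonneg hθ.le (by linarith)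
  have hS : ∀ n, P (S n) ≤ ENNReal.ofReal B := by
    intro n
    set ε : ℝ := 1 / ((n : ℝ) + 1) with hεdef
    have hε0 : 0 < ε := hε n
    have hε1 : ε ≤ 1 := by
      rw [hεdef, div_le_one (by positivity)]
      linarith [n.cast_nonneg (α := ℝ)]
    have hle : ∫⁻ ω, ENNReal.ofReal ((X t ω + ε) ^ (-θ) *
        Real.exp (-∫ s in (0 : ℝ)..t, besselRate d ε (-θ) (X s ω))) ∂P ≤
        ENNReal.ofReal (z ^ (-θ)) := by
      refine (hX.lintegral_le ε hε0 (-θ) t ht).trans (ENNReal.ofReal_le_ofReal ?_)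
      exact Real.rpow_le_rpow_of_nonpos hz (by linarith) (by linarith)
    have hmeas := hX.measurable_integral_besselRate ε (-θ) ht
    refine measure_le_ofReal_div (Measurable.aemeasurable ?_) (by positivity) hle
      (ae_of_all _ fun ω hω => ?_)
    · exact (((hX.measurable t).add_const ε).pow_const _).mul hmeas.neg.exp
    · obtain ⟨h1, h2⟩ := hω
      have h0 := hX.nonneg t ω
      refine mul_le_mul (Real.rpow_le_rpow_of_nonpos (by linarith) (by linarith) (by linarith)) ?_
        (Real.exp_pos _).le (by positivity)
      refine Real.exp_le_exp.2 ?_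
      calc θ * (d - 2 - 2 * θ) * b
          ≤ θ * (d - 2 - 2 * θ) * ∫ s in (0 : ℝ)..t, 1 / (X s ω + ε) := by gcongr
        _ = ∫ s in (0 : ℝ)..t, θ * (d - 2 - 2 * θ) * (1 / (X s ω + ε)) := by
            rw [intervalIntegral.integral_const_mul]
        _ ≤ ∫ s in (0 : ℝ)..t, -besselRate d ε (-θ) (X s ω) := by
            refine intervalIntegral.integral_mono_on ht
              (((hX.continuous_integrand hε0 ω).const_mul _).intervalIntegrable _ _)
              ((hX.continuous_besselRate hε0 _ ω).neg.intervalIntegrable _ _) fun s _ => ?_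
            have hs := hX.nonneg s ω
            set y := X s ω
            have hy : 0 < y + ε := by linarith
            have : -besselRate d ε (-θ) y - θ * (d - 2 - 2 * θ) * (1 / (y + ε)) =
                2 * θ * (θ + 1) * ε / (y + ε) ^ 2 := by
              rw [besselRate]
              field_simp
              ring
            have h3 : 0 ≤ 2 * θ * (θ + 1) * ε / (y + ε) ^ 2 := by positivity
            linarith
        _ = _ := intervalIntegral.integral_neg
  have hmono : Monotone S := by
    intro n m hnm ω hω
    refine ⟨hω.1, hω.2.trans_le ?_⟩
    refine intervalIntegral.integral_mono_on ht
      ((hX.continuous_integrand (hε n) ω).intervalIntegrable _ _)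
      ((hX.continuous_integrand (hε m) ω).intervalIntegrable _ _) fun s _ => ?_
    have hs := hX.nonneg s ω
    have := Nat.one_div_le_one_div (α := ℝ) hnm
    have := hε m
    gcongr
  have hsub : {ω | X t ω ≤ T ∧ ENNReal.ofReal b < inverseClock (fun s => X s ω) t} ⊆ ⋃ n, S n := by
    rintro ω ⟨h1, h2⟩
    have hlim := tendsto_integral_inv_add (hX.continuous ω) (fun s => hX.nonneg s ω) ht
    obtain ⟨n, hn⟩ := (hlim.eventually (lt_mem_nhds h2)).exists
    exact Set.mem_iUnion.2 ⟨n, h1, ((ENNReal.ofReal_lt_ofReal_iff_of_nonneg hb).1 hn)⟩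
  refine (measure_mono hsub).trans ?_
  rw [hmono.measure_iUnion]
  exact iSup_le hS

/-- The clock stays finite: the process spends no time at zero, and its inverse is integrable. -/
theorem ae_inverseClock_lt_top (hX : HasBesselMoments d z X P) (hz : 0 < z) (hd : 2 < d) :
    ∀ᵐ ω ∂P, ∀ t, inverseClock (fun s => X s ω) t < ⊤ := by
  set θ := (d - 2) / 4 with hθ
  have hθ0 : 0 < θ := by rw [hθ]; linarith
  have key : ∀ n m : ℕ, P {ω | X n ω ≤ m ∧ inverseClock (fun s => X s ω) n = ⊤} = 0 := by
    intro n m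
    have hc : 0 < θ * (d - 2 - 2 * θ) := by
      rw [hθ]
      have : 0 < d - 2 := by linarith
      nlinarith
    have hlim : Tendsto (fun k : ℕ => ENNReal.ofReal
        (z ^ (-θ) / (((m : ℝ) + 1) ^ (-θ) * Real.exp (θ * (d - 2 - 2 * θ) * k)))) atTop
        (nhds 0) := by
      rw [← ENNReal.ofReal_zero]
      refine ENNReal.tendsto_ofReal (Tendsto.div_atTop tendsto_const_nhds ?_)
      refine Tendsto.const_mul_atTop (by positivity) (Real.tendsto_exp_atTop.comp ?_)
      exact tendsto_natCast_atTop_atTop.const_mul_atTop hc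
    refine le_antisymm (ge_of_tendsto' hlim fun k => ?_) zero_le
    refine (measure_mono ?_).trans (hX.measure_le_and_lt_inverseClock_le hz hθ0 (by linarith)
      n.cast_nonneg m.cast_nonneg k.cast_nonneg)
    rintro ω ⟨h1, h2⟩
    exact ⟨h1, by rw [h2]; exact ENNReal.ofReal_lt_top⟩
  have hall : ∀ᵐ ω ∂P, ∀ n m : ℕ, ¬(X n ω ≤ m ∧ inverseClock (fun s => X s ω) n = ⊤) := by
    rw [ae_all_iff]; intro n
    rw [ae_all_iff]; intro m
    rw [ae_iff]
    simpa using key n m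
  filter_upwards [hall] with ω hω t
  obtain ⟨n, hn⟩ := exists_nat_ge t
  obtain ⟨m, hm⟩ := exists_nat_ge (X n ω)
  refine lt_of_le_of_lt (inverseClock_mono _ hn) (lt_top_iff_ne_top.2 fun h => hω n m ⟨hm, h⟩)

/-- The first-moment inequality bounds the upper tail of the endpoint. -/
theorem measure_lt_le (hX : HasBesselMoments d z X P) (hd : 0 ≤ d) {t T : ℝ} (ht : 0 < t)
    (hT : 0 < T) : P {ω | T < X t ω} ≤ ENNReal.ofReal ((z + t) / (T * Real.exp (-d))) := by
  have h := hX.lintegral_le t ht 1 t ht.le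
  rw [Real.rpow_one] at h
  have hmeas := hX.measurable_integral_besselRate t 1 ht.le
  refine measure_le_ofReal_div (Measurable.aemeasurable ?_) (by positivity) h
    (ae_of_all _ fun ω hω => ?_)
  · exact (((hX.measurable t).add_const t).pow_const _).mul hmeas.neg.exp
  · have h0 : T < X t ω := hω
    rw [Real.rpow_one]
    refine mul_le_mul (by linarith) (Real.exp_le_exp.2 (neg_le_neg ?_)) (Real.exp_pos _).le
      (by linarith)
    calc ∫ s in (0 : ℝ)..t, besselRate d t 1 (X s ω) ≤ ∫ s in (0 : ℝ)..t, d / t := by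
          refine intervalIntegral.integral_mono_on ht.le
            ((hX.continuous_besselRate ht _ ω).intervalIntegrable _ _) (by simp) fun s _ => ?_
          have hs := hX.nonneg s ω
          simp only [besselRate, one_mul, sub_self, mul_zero, zero_mul, zero_div, add_zero]
          gcongr
          linarith
      _ = d := by
          rw [intervalIntegral.integral_const, smul_eq_mul, sub_zero]
          field_simp

/-- The positive-power inequality, in the limit of vanishing regularisation. -/
theorem lintegral_rpow_mul_exp_le (hX : HasBesselMoments d z X P) (hz : 0 < z) (hd : 2 < d) {θ : ℝ}
    (hθ : 0 < θ) {t : ℝ} (ht : 0 ≤ t) :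
    ∫⁻ ω, ENNReal.ofReal (X t ω ^ θ *
      Real.exp (-(θ * (d - 2 + 2 * θ) * ∫ s in (0 : ℝ)..t, 1 / X s ω))) ∂P ≤
        ENNReal.ofReal (z ^ θ) := by
  let ε : ℕ → ℝ := fun n => 1 / ((n : ℝ) + 1)
  have hε : ∀ n : ℕ, 0 < ε n := fun n => Nat.one_div_pos_of_nat
  have hεlim : Tendsto ε atTop (nhds 0) := tendsto_one_div_add_atTop_nhds_zero_nat
  let Φ : ℕ → Ω → ENNReal := fun n ω => ENNReal.ofReal ((X t ω + ε n) ^ θ *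
      Real.exp (-∫ s in (0 : ℝ)..t, besselRate d (ε n) θ (X s ω)))
  have hlim : ∀ᵐ ω ∂P, Tendsto (fun n => Φ n ω) atTop (nhds (ENNReal.ofReal (X t ω ^ θ *
      Real.exp (-(θ * (d - 2 + 2 * θ) * ∫ s in (0 : ℝ)..t, 1 / X s ω))))) := by
    filter_upwards [hX.ae_inverseClock_lt_top hz hd] with ω hω
    have hpos := ae_pos_of_inverseClock_lt_top (hX.continuous ω) (hω t)
    have hint := (integrable_inv_of_inverseClock_lt_top (hX.continuous ω) ht (hω t)).1
    have h1 : Tendsto (fun n => (X t ω + ε n) ^ θ) atTop (nhds (X t ω ^ θ)) := by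
      have := (hεlim.const_add (X t ω)).rpow_const (p := θ) (Or.inr hθ.le)
      simpa using this
    have h2 : Tendsto (fun n => ∫ s in (0 : ℝ)..t, besselRate d (ε n) θ (X s ω)) atTop
        (nhds (∫ s in (0 : ℝ)..t, θ * (d - 2 + 2 * θ) * (1 / X s ω))) := by
      refine intervalIntegral.tendsto_integral_filter_of_dominated_convergence
        (fun s => (θ * d + 2 * θ * |θ - 1|) * (1 / X s ω))
        (Eventually.of_forall fun n =>
          (hX.continuous_besselRate (hε n) θ ω).aestronglyMeasurable)
        (Eventually.of_forall fun n => ?_) (hint.const_mul _) ?_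
      · rw [Set.uIoc_of_le ht]
        refine (ae_restrict_iff' measurableSet_Ioc).1 ?_
        filter_upwards [hpos] with s hs
        set y := X s ω
        have hen := hε n
        have hy : 0 < y + ε n := by linarith
        have k1 : 1 / (y + ε n) ≤ 1 / y := one_div_le_one_div_of_le hs (by linarith)
        have k2 : y / (y + ε n) ^ 2 ≤ 1 / y := by
          rw [div_le_div_iff₀ (by positivity) hs]
          nlinarith
        have e : besselRate d (ε n) θ y =
            θ * d * (1 / (y + ε n)) + 2 * θ * (θ - 1) * (y / (y + ε n) ^ 2) := by
          rw [besselRate]; ring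
        rw [e, Real.norm_eq_abs]
        refine (abs_add_le _ _).trans ?_
        rw [abs_mul, abs_mul (2 * θ * (θ - 1)), abs_mul (2 * θ),
          abs_of_nonneg (by positivity : 0 ≤ 1 / (y + ε n)),
          abs_of_nonneg (by positivity : 0 ≤ y / (y + ε n) ^ 2),
          abs_of_pos (by positivity : 0 < 2 * θ),
          abs_of_nonneg (mul_nonneg hθ.le (by linarith) : 0 ≤ θ * d), add_mul]
        gcongr
      · rw [Set.uIoc_of_le ht]
        refine (ae_restrict_iff' measurableSet_Ioc).1 ?_
        filter_upwards [hpos] with s hs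
        have k0 : Tendsto (fun n => X s ω + ε n) atTop (nhds (X s ω)) := by
          simpa using hεlim.const_add (X s ω)
        have := ((tendsto_const_nhds (x := θ * d)).div k0 hs.ne').add
          ((tendsto_const_nhds (x := 2 * θ * (θ - 1) * X s ω)).div (k0.pow 2)
            (pow_ne_zero 2 hs.ne'))
        have e : θ * d / X s ω + 2 * θ * (θ - 1) * X s ω / X s ω ^ 2 =
            θ * (d - 2 + 2 * θ) * (1 / X s ω) := by
          field_simp
          ring
        rw [e] at this
        exact this
    rw [intervalIntegral.integral_const_mul] at h2
    exact ENNReal.tendsto_ofReal (h1.mul h2.neg.rexp)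
  have hm : ∀ n, Measurable (Φ n) := fun n =>
    ((((hX.measurable t).add_const _).pow_const _).mul
      (hX.measurable_integral_besselRate _ _ ht).neg.exp).ennreal_ofReal
  calc _ = ∫⁻ ω, liminf (fun n => Φ n ω) atTop ∂P := by
        refine lintegral_congr_ae ?_
        filter_upwards [hlim] with ω hω using hω.liminf_eq.symm
    _ ≤ liminf (fun n => ∫⁻ ω, Φ n ω ∂P) atTop := lintegral_liminf_le hm
    _ ≤ liminf (fun n => ENNReal.ofReal ((z + ε n) ^ θ)) atTop :=
        liminf_le_liminf (Eventually.of_forall fun n => hX.lintegral_le _ (hε n) _ _ ht)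
    _ = ENNReal.ofReal (z ^ θ) := by
        have h := (hεlim.const_add z).rpow_const (p := θ) (Or.inr hθ.le)
        rw [add_zero] at h
        exact (ENNReal.tendsto_ofReal h).liminf_eq

/-- A small clock is unlikely: as long as the clock is small the process is small, by the
positive-power inequality at each time, and a process that is small most of the time has a large
clock. -/
theorem measure_inverseClock_le_le (hX : HasBesselMoments d z X P) (hz : 0 < z) (hd : 2 < d)
    {θ : ℝ} (hθ : 0 < θ) {r T b : ℝ} (hr : 0 < r) (hT : 0 < T) (hb : 0 ≤ b) (hTb : T * b ≤ r / 2)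
    [SFinite P] :
    P {ω | inverseClock (fun s => X s ω) r ≤ ENNReal.ofReal b} ≤
      ENNReal.ofReal (r * (z ^ θ * Real.exp (θ * (d - 2 + 2 * θ) * b)) / (T ^ θ * (r / 2))) := by
  set q := θ * (d - 2 + 2 * θ) with hq
  have hq0 : 0 ≤ q := mul_nonneg hθ.le (by linarith)
  set E : Set Ω := {ω | inverseClock (fun s => X s ω) r ≤ ENNReal.ofReal b} with hE
  have hEm : MeasurableSet E := measurableSet_le (hX.measurable_inverseClock r) measurable_const
  have hclock : ∀ᵐ ω ∂P, ∀ s ∈ Set.Ioc 0 r, ω ∈ E → ∫ u in (0 : ℝ)..s, 1 / X u ω ≤ b := by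
    filter_upwards [hX.ae_inverseClock_lt_top hz hd] with ω hω s hs hωE
    have h1 := (integrable_inv_of_inverseClock_lt_top (hX.continuous ω) hs.1.le (hω s)).2
    have h2 : inverseClock (fun s => X s ω) s ≤ ENNReal.ofReal b :=
      (inverseClock_mono _ hs.2).trans hωE
    rw [← h1] at h2
    exact (ENNReal.ofReal_le_ofReal_iff hb).1 h2
  have hfix : ∀ s ∈ Set.Ioc 0 r, ∫⁻ ω, E.indicator (fun ω => ENNReal.ofReal (X s ω ^ θ)) ω ∂P ≤
      ENNReal.ofReal (z ^ θ * Real.exp (q * b)) := by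
    intro s hs
    have hle := hX.lintegral_rpow_mul_exp_le hz hd hθ hs.1.le
    calc ∫⁻ ω, E.indicator (fun ω => ENNReal.ofReal (X s ω ^ θ)) ω ∂P
        ≤ ∫⁻ ω, ENNReal.ofReal (X s ω ^ θ * Real.exp (-(q * ∫ u in (0 : ℝ)..s, 1 / X u ω))) *
            ENNReal.ofReal (Real.exp (q * b)) ∂P := by
          refine lintegral_mono_ae ?_
          filter_upwards [hclock] with ω hω
          by_cases hωE : ω ∈ E
          · rw [Set.indicator_of_mem hωE, ← ENNReal.ofReal_mul
              (mul_nonneg (Real.rpow_nonneg (hX.nonneg s ω) _) (Real.exp_pos _).le)]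
            refine ENNReal.ofReal_le_ofReal ?_
            rw [mul_assoc, ← Real.exp_add]
            refine le_mul_of_one_le_right (Real.rpow_nonneg (hX.nonneg s ω) _)
              (Real.one_le_exp ?_)
            have := mul_le_mul_of_nonneg_left (hω s hs hωE) hq0
            linarith
          · rw [Set.indicator_of_notMem hωE]
            exact zero_le
      _ = (∫⁻ ω, ENNReal.ofReal (X s ω ^ θ * Real.exp (-(q * ∫ u in (0 : ℝ)..s, 1 / X u ω))) ∂P) *
            ENNReal.ofReal (Real.exp (q * b)) := lintegral_mul_const' _ _ ENNReal.ofReal_ne_top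
      _ ≤ ENNReal.ofReal (z ^ θ) * ENNReal.ofReal (Real.exp (q * b)) := by gcongr
      _ = _ := by rw [← ENNReal.ofReal_mul (by positivity)]
  have hXθ : ∀ ω, Continuous fun s => X s ω ^ θ := fun ω =>
    (hX.continuous ω).rpow_const fun s => Or.inr hθ.le
  have hm2 : Measurable fun q : Ω × ℝ => X q.2 q.1 ^ θ := hX.measurable_uncurry.pow_const _
  let f : Ω → ℝ := E.indicator fun ω => ∫ s in (0 : ℝ)..r, X s ω ^ θ
  have hfm : Measurable f := by
    refine Measurable.indicator ?_ hEm
    simp_rw [intervalIntegral.integral_of_le hr.le]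
    exact (hm2.stronglyMeasurable.integral_prod_right'
      (ν := volume.restrict (Set.Ioc 0 r))).measurable
  have hfint : ∫⁻ ω, ENNReal.ofReal (f ω) ∂P ≤
      ENNReal.ofReal (r * (z ^ θ * Real.exp (q * b))) := by
    have e : ∀ ω, ENNReal.ofReal (f ω) =
        ∫⁻ s in Set.Ioc 0 r, E.indicator (fun ω => ENNReal.ofReal (X s ω ^ θ)) ω := by
      intro ω
      by_cases hωE : ω ∈ E
      · simp only [f, Set.indicator_of_mem hωE]
        rw [intervalIntegral.integral_of_le hr.le, ofReal_integral_eq_lintegral_ofReal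
          ((hXθ ω).integrableOn_Icc.mono_set Set.Ioc_subset_Icc_self)
          (ae_of_all _ fun s => Real.rpow_nonneg (hX.nonneg s ω) _)]
      · simp [f, Set.indicator_of_notMem hωE]
    simp_rw [e]
    rw [lintegral_lintegral_swap]
    · calc ∫⁻ s in Set.Ioc 0 r, ∫⁻ ω, E.indicator (fun ω => ENNReal.ofReal (X s ω ^ θ)) ω ∂P
          ≤ ∫⁻ s in Set.Ioc 0 r, ENNReal.ofReal (z ^ θ * Real.exp (q * b)) :=
            setLIntegral_mono measurable_const hfix
        _ = _ := by
            rw [setLIntegral_const, Real.volume_Ioc, sub_zero, mul_comm,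
              ← ENNReal.ofReal_mul hr.le]
    · have : (Function.uncurry fun (ω : Ω) (s : ℝ) =>
          E.indicator (fun ω => ENNReal.ofReal (X s ω ^ θ)) ω) =
          (Prod.fst ⁻¹' E).indicator fun q : Ω × ℝ => ENNReal.ofReal (X q.2 q.1 ^ θ) := by
        ext q
        by_cases hq : q.1 ∈ E <;> simp [Function.uncurry, hq]
      rw [this]
      exact (hm2.ennreal_ofReal.indicator (measurable_fst hEm)).aemeasurable
  refine measure_le_ofReal_div hfm.aemeasurable (by positivity) hfint ?_
  filter_upwards [hclock, hX.ae_inverseClock_lt_top hz hd] with ω hω hfin hωE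
  simp only [f, Set.indicator_of_mem hωE]
  have hA := hω r ⟨hr, le_rfl⟩ hωE
  have hpos := ae_pos_of_inverseClock_lt_top (hX.continuous ω) (hfin r)
  have hint := (integrable_inv_of_inverseClock_lt_top (hX.continuous ω) hr.le (hfin r)).1
  have hTθ : 0 < T ^ θ := Real.rpow_pos_of_pos hT _
  -- at each time, either `X ≥ T` or `X ≤ T`
  have hcmp : ∫ s in (0 : ℝ)..r, (1 : ℝ) ≤
      ∫ s in (0 : ℝ)..r, ((T ^ θ)⁻¹ * X s ω ^ θ + T * (1 / X s ω)) := by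
    refine intervalIntegral.integral_mono_ae_restrict hr.le (by simp)
      ((((hXθ ω).const_mul _).intervalIntegrable _ _).add (hint.const_mul _)) ?_
    have hpos' : ∀ᵐ s ∂(volume.restrict (Set.Icc 0 r)), 0 < X s ω := by
      rwa [Measure.restrict_congr_set Ioc_ae_eq_Icc.symm]
    filter_upwards [hpos'] with s hs
    rcases le_total T (X s ω) with h | h
    · have h1 : T ^ θ ≤ X s ω ^ θ := Real.rpow_le_rpow hT.le h hθ.le
      have h2 : 1 ≤ (T ^ θ)⁻¹ * X s ω ^ θ := by
        rw [inv_mul_eq_div, one_le_div hTθ]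
        exact h1
      have h3 : 0 ≤ T * (1 / X s ω) := by positivity
      linarith
    · have h1 : 0 ≤ (T ^ θ)⁻¹ * X s ω ^ θ := by positivity
      have h2 : 1 ≤ T * (1 / X s ω) := by
        rw [mul_one_div, one_le_div hs]
        exact h
      linarith
  rw [intervalIntegral.integral_add (((hXθ ω).const_mul _).intervalIntegrable _ _)
    (hint.const_mul _), intervalIntegral.integral_const_mul, intervalIntegral.integral_const_mul,
    intervalIntegral.integral_const, smul_eq_mul, mul_one, sub_zero] at hcmp
  have h1 : T * (∫ s in (0 : ℝ)..r, 1 / X s ω) ≤ r / 2 :=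
    (mul_le_mul_of_nonneg_left hA hT.le).trans hTb
  have h2 : r / 2 ≤ (T ^ θ)⁻¹ * ∫ s in (0 : ℝ)..r, X s ω ^ θ := by linarith
  rw [inv_mul_eq_div, le_div_iff₀ hTθ] at h2
  linarith

end HasBesselMoments

end BrownianPotential

/-! ### Deviation inequality for the clock of a Bessel process -/

namespace BrownianPotential

/-- The polynomial deviation inequality, for small deviations `δ`. The exponents are
`θ = a² δ / 8` for the power of the process, and `η = a δ / 4` for the range
`[r ^ (1 - η), r ^ (1 + η)]` of the endpoint, where `a = d - 2`. -/
theorem HasBesselMoments.measure_deviation_le {Ω : Type*} [MeasurableSpace Ω] {P : Measure Ω}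
    [IsProbabilityMeasure P] {X : ℝ → Ω → ℝ} {d : ℝ} (hX : HasBesselMoments d 4 X P) (hd : 2 < d)
    {δ : ℝ} (hδ : 0 < δ) (hδd : (d - 2) * δ ≤ 1 / 2) {r : ℝ}
    (hr : Real.exp (4 / ((d - 2) * ((d - 2) * δ / 4) ^ 2)) ≤ r) :
    P {ω | |1 / Real.log r * (∫ s in (0 : ℝ)..r, 1 / X s ω) - 1 / (d - 2)| > δ} ≤
      ENNReal.ofReal ((1 + 5 * Real.exp d + 2 * 4 ^ ((d - 2) ^ 2 * δ / 8)) *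
        Real.exp (-(min ((d - 2) ^ 2 * δ / 8 * (3 * ((d - 2) * δ) / 8)) ((d - 2) * δ / 4)) *
          Real.log r)) := by
  obtain ⟨a, ha⟩ : ∃ a, a = d - 2 := ⟨_, rfl⟩
  rw [← ha] at hδd hr ⊢
  have ha0 : 0 < a := by linarith
  obtain ⟨u, hu⟩ : ∃ u, u = a * δ := ⟨_, rfl⟩
  have hu0 : 0 < u := by rw [hu]; positivity
  rw [← hu] at hδd hr ⊢
  obtain ⟨θ, hθ⟩ : ∃ θ, θ = a ^ 2 * δ / 8 := ⟨_, rfl⟩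
  have hθ0 : 0 < θ := by rw [hθ]; positivity
  have hθu : θ = a * u / 8 := by rw [hθ, hu]; ring
  rw [← hθ]
  obtain ⟨η, hη⟩ : ∃ η, η = u / 4 := ⟨_, rfl⟩
  have hη0 : 0 < η := by rw [hη]; positivity
  rw [← hη] at hr ⊢
  set L := Real.log r with hL
  have hr0 : 0 < r := (Real.exp_pos _).trans_le hr
  have hrL : r = Real.exp L := (Real.exp_log hr0).symm
  have hLbig : 4 / (a * η ^ 2) ≤ L := (Real.le_log_iff_exp_le hr0).2 hr
  have hL0 : 0 < L := lt_of_lt_of_le (by positivity) hLbig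
  set c := min (θ * (3 * u / 8)) η with hc
  have hδau : 1 / a + δ = (1 + u) / a := by rw [hu]; field_simp
  have hδau' : 1 / a - δ = (1 - u) / a := by rw [hu]; field_simp
  -- the endpoint is not too large
  have hend : P {ω | Real.exp ((1 + η) * L) < X r ω} ≤
      ENNReal.ofReal (5 * Real.exp d * Real.exp (-c * L)) := by
    refine (hX.measure_lt_le (by linarith) hr0 (Real.exp_pos _)).trans
      (ENNReal.ofReal_le_ofReal ?_)
    rw [← Real.exp_add, div_eq_mul_inv, ← Real.exp_neg]
    have h1 : 4 + r ≤ 5 * Real.exp L := by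
      have := Real.one_le_exp hL0.le
      rw [← hrL] at this ⊢
      linarith
    calc (4 + r) * Real.exp (-((1 + η) * L + -d))
        ≤ 5 * Real.exp L * Real.exp (-((1 + η) * L + -d)) := by gcongr
      _ = 5 * Real.exp d * Real.exp (-η * L) := by
          rw [mul_assoc, mul_assoc, ← Real.exp_add, ← Real.exp_add]
          ring_nf
      _ ≤ _ := by
          have : c ≤ η := min_le_right _ _
          gcongr
  have hup : P {ω | X r ω ≤ Real.exp ((1 + η) * L) ∧
      ENNReal.ofReal ((1 / a + δ) * L) < inverseClock (fun s => X s ω) r} ≤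
      ENNReal.ofReal (Real.exp (-c * L)) := by
    refine (hX.measure_le_and_lt_inverseClock_le (by norm_num) hθ0 ?_ hr0.le (Real.exp_pos _).le
      (by positivity)).trans (ENNReal.ofReal_le_ofReal ?_)
    · rw [← ha, hθu]
      nlinarith
    rw [← ha, Real.rpow_neg (by norm_num), Real.rpow_neg (by positivity)]
    set T := Real.exp ((1 + η) * L) with hT
    have hT1 : 1 ≤ T := Real.one_le_exp (by positivity)
    have h4 : (T + 1) ^ θ ≤ 4 ^ θ * Real.exp (θ * ((1 + η) * L)) := by
      have : (4 * T) ^ θ = 4 ^ θ * Real.exp (θ * ((1 + η) * L)) := by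
        rw [Real.mul_rpow (by norm_num) (by positivity), hT, ← Real.exp_mul]
        ring_nf
      rw [← this]
      exact Real.rpow_le_rpow (by positivity) (by linarith) hθ0.le
    have h4pos : (0 : ℝ) < 4 ^ θ := by positivity
    have hTpos : (0 : ℝ) < (T + 1) ^ θ := by positivity
    calc (4 ^ θ)⁻¹ / (((T + 1) ^ θ)⁻¹ * Real.exp (θ * (a - 2 * θ) * ((1 / a + δ) * L)))
        = (4 ^ θ)⁻¹ * (T + 1) ^ θ * Real.exp (-(θ * (a - 2 * θ) * ((1 / a + δ) * L))) := by
          rw [Real.exp_neg]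
          field_simp
      _ ≤ (4 ^ θ)⁻¹ * (4 ^ θ * Real.exp (θ * ((1 + η) * L))) *
            Real.exp (-(θ * (a - 2 * θ) * ((1 / a + δ) * L))) := by gcongr
      _ = Real.exp (θ * ((1 + η) * L) + -(θ * (a - 2 * θ) * ((1 / a + δ) * L))) := by
          rw [← mul_assoc, inv_mul_cancel₀ h4pos.ne', one_mul, Real.exp_add]
      _ ≤ _ := by
          refine Real.exp_le_exp.2 ?_
          have e : (a - 2 * θ) * (1 / a + δ) = (1 - u / 4) * (1 + u) := by
            rw [hδau, hθu]
            field_simp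
            ring
          have h5 : θ * ((1 + η) * L) + -(θ * (a - 2 * θ) * ((1 / a + δ) * L)) =
              -(θ * (u / 2 - u ^ 2 / 4)) * L := by
            rw [show θ * (a - 2 * θ) * ((1 / a + δ) * L) =
              θ * ((a - 2 * θ) * (1 / a + δ)) * L by ring, e, hη]
            ring
          rw [h5]
          have h6 : c ≤ θ * (u / 2 - u ^ 2 / 4) := by
            refine (min_le_left _ _).trans ?_
            gcongr
            nlinarith
          have := mul_le_mul_of_nonneg_right h6 hL0.le
          linarith
  have hlow : P {ω | inverseClock (fun s => X s ω) r ≤ ENNReal.ofReal ((1 / a - δ) * L)} ≤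
      ENNReal.ofReal (2 * 4 ^ θ * Real.exp (-c * L)) := by
    have hb : 0 ≤ (1 / a - δ) * L := by
      rw [hδau']
      have : 0 ≤ 1 - u := by linarith
      positivity
    refine (hX.measure_inverseClock_le_le (by norm_num) hd hθ0 hr0
      (Real.exp_pos ((1 - η) * L)) hb ?_).trans (ENNReal.ofReal_le_ofReal ?_)
    · -- the clock needed at height `r ^ (1 - η)` is a power of `r`, hence exceeds `log r`
      have h1 : (1 / a - δ) * L ≤ L / a := by
        rw [hδau', div_mul_eq_mul_div]
        gcongr
        nlinarith
      have h2 := Real.quadratic_le_exp_of_nonneg (x := η * L) (by positivity)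
      have h3 : L / a ≤ Real.exp (η * L) / 2 := by
        rw [div_le_iff₀ ha0]
        rw [div_le_iff₀ (by positivity)] at hLbig
        have h6 : 4 * L ≤ a * (η * L) ^ 2 := by nlinarith
        have h7 : 0 ≤ η * L := by positivity
        nlinarith
      calc Real.exp ((1 - η) * L) * ((1 / a - δ) * L)
          ≤ Real.exp ((1 - η) * L) * (Real.exp (η * L) / 2) := by
            gcongr
            exact h1.trans h3
        _ = r / 2 := by
            rw [hrL, ← mul_div_assoc, ← Real.exp_add]
            ring_nf
    · rw [← ha, ← Real.exp_mul]
      calc r * (4 ^ θ * Real.exp (θ * (a + 2 * θ) * ((1 / a - δ) * L))) /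
            (Real.exp ((1 - η) * L * θ) * (r / 2))
          = 2 * 4 ^ θ * (Real.exp (θ * (a + 2 * θ) * ((1 / a - δ) * L)) *
              Real.exp (-((1 - η) * L * θ))) := by
            rw [Real.exp_neg]
            field_simp
        _ ≤ _ := by
            rw [← Real.exp_add]
            gcongr
            have e : (a + 2 * θ) * (1 / a - δ) = (1 + u / 4) * (1 - u) := by
              rw [hδau', hθu]
              field_simp
              ring
            have h5 : θ * (a + 2 * θ) * ((1 / a - δ) * L) + -((1 - η) * L * θ) =
                -(θ * (u / 2 + u ^ 2 / 4)) * L := by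
              rw [show θ * (a + 2 * θ) * ((1 / a - δ) * L) =
                θ * ((a + 2 * θ) * (1 / a - δ)) * L by ring, e, hη]
              ring
            rw [h5]
            have h6 : c ≤ θ * (u / 2 + u ^ 2 / 4) := by
              refine (min_le_left _ _).trans ?_
              gcongr
              nlinarith [sq_nonneg u]
            have := mul_le_mul_of_nonneg_right h6 hL0.le
            linarith
  have hsub : P {ω | |1 / L * (∫ s in (0 : ℝ)..r, 1 / X s ω) - 1 / a| > δ} ≤
      P (({ω | X r ω ≤ Real.exp ((1 + η) * L) ∧
          ENNReal.ofReal ((1 / a + δ) * L) < inverseClock (fun s => X s ω) r} ∪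
        {ω | Real.exp ((1 + η) * L) < X r ω}) ∪
        {ω | inverseClock (fun s => X s ω) r ≤ ENNReal.ofReal ((1 / a - δ) * L)}) := by
    refine measure_mono_ae ?_
    filter_upwards [hX.ae_inverseClock_lt_top (by norm_num) hd] with ω hω hmem
    have hA := (integrable_inv_of_inverseClock_lt_top (hX.continuous ω) hr0.le (hω r)).2
    change |1 / L * (∫ s in (0 : ℝ)..r, 1 / X s ω) - 1 / a| > δ at hmem
    set A := ∫ s in (0 : ℝ)..r, 1 / X s ω
    rcases lt_abs.1 hmem with h | h
    · have h1 : (1 / a + δ) * L < A := by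
        have : 1 / a + δ < 1 / L * A := by linarith
        rwa [one_div_mul_eq_div, lt_div_iff₀ hL0] at this
      refine Or.inl ?_
      rcases le_or_gt (X r ω) (Real.exp ((1 + η) * L)) with h2 | h2
      · refine Or.inl ⟨h2, ?_⟩
        rw [← hA]
        exact (ENNReal.ofReal_lt_ofReal_iff_of_nonneg (by positivity)).2 h1
      · exact Or.inr h2
    · have h1 : A < (1 / a - δ) * L := by
        have : 1 / L * A < 1 / a - δ := by linarith
        rwa [one_div_mul_eq_div, div_lt_iff₀ hL0] at this
      refine Or.inr ?_
      change inverseClock (fun s => X s ω) r ≤ _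
      rw [← hA]
      exact ENNReal.ofReal_le_ofReal h1.le
  refine hsub.trans ((measure_union_le _ _).trans
    ((add_le_add ((measure_union_le _ _).trans (add_le_add hup hend)) hlow).trans ?_))
  rw [← ENNReal.ofReal_add (by positivity) (by positivity),
    ← ENNReal.ofReal_add (by positivity) (by positivity)]
  refine ENNReal.ofReal_le_ofReal (le_of_eq ?_)
  ring

/-- The squared Bessel process started at `4` satisfies the exponential functional inequality. -/
theorem IsBessel.exists_hasBesselMoments {Ω : Type*} [MeasurableSpace Ω] {P : Measure Ω}
    [IsProbabilityMeasure P] {d : ℝ} (hd : 0 ≤ d) {R : ℝ≥0 → Ω → ℝ} (hR : IsBessel d 2 R P) :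
    ∃ X : ℝ → Ω → ℝ, HasBesselMoments d 4 X P ∧
      ∀ᵐ ω ∂P, ∀ s : ℝ, 1 / R s.toNNReal ω ^ 2 = 1 / X s ω := by
  obtain ⟨Y, hYm, hYc, -, hY, hle⟩ := hR.exists_version_lintegral_le hd zero_le_two
  refine ⟨fun s ω => Y s.toNNReal ω ^ 2, ⟨fun t => (hYm _).pow_const 2,
    fun ω => ((hYc ω).comp continuous_real_toNNReal).pow 2, fun t ω => sq_nonneg _,
    fun ε hε p t ht => ?_⟩, ?_⟩
  · have := hle ε hε p t.toNNReal
    rw [Real.coe_toNNReal t ht] at this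
    norm_num at this
    exact this
  · filter_upwards [hY] with ω hω s
    rw [hω]

/-- The clock of a Bessel process of dimension `d > 2` is finite, and is polynomially close to
`log r / (d - 2)`. -/
theorem bessel_deviation {d δ : ℝ} (hd : 2 < d) (hδ : 0 < δ) :
    ∃ c₃ c₄ r₀ : ℝ, 0 < c₃ ∧ 0 < c₄ ∧ 1 < r₀ ∧
      ∀ (Ω : Type*) [MeasurableSpace Ω] (P : Measure Ω) [IsProbabilityMeasure P]
        (R : ℝ≥0 → Ω → ℝ), IsBessel d 2 R P →
        (∀ᵐ ω ∂P, ∀ r : ℝ, 0 ≤ r →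
          IntervalIntegrable (fun s : ℝ => 1 / R s.toNNReal ω ^ 2) volume 0 r) ∧
        ∀ r : ℝ, r₀ ≤ r →
          P.real {ω | |1 / Real.log r * (∫ s in (0 : ℝ)..r, 1 / R s.toNNReal ω ^ 2)
              - 1 / (d - 2)| > δ} ≤ c₃ / r ^ c₄ := by
  have ha : 0 < d - 2 := by linarith
  -- it suffices to consider small deviations
  set δ' := min δ (1 / (2 * (d - 2))) with hδ'
  have hδ'0 : 0 < δ' := lt_min hδ (by positivity)
  have hδ'd : (d - 2) * δ' ≤ 1 / 2 := by
    calc (d - 2) * δ' ≤ (d - 2) * (1 / (2 * (d - 2))) := by gcongr; exact min_le_right _ _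
      _ = 1 / 2 := by field_simp
  set c₄ := min ((d - 2) ^ 2 * δ' / 8 * (3 * ((d - 2) * δ') / 8)) ((d - 2) * δ' / 4) with hc₄
  refine ⟨1 + 5 * Real.exp d + 2 * 4 ^ ((d - 2) ^ 2 * δ' / 8), c₄,
    Real.exp (4 / ((d - 2) * ((d - 2) * δ' / 4) ^ 2)), by positivity,
    lt_min (by positivity) (by positivity), Real.one_lt_exp_iff.2 (by positivity), ?_⟩
  intro Ω _ P _ R hR
  obtain ⟨X, hX, hXR⟩ := hR.exists_hasBesselMoments (by linarith)
  constructor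
  · filter_upwards [hX.ae_inverseClock_lt_top (by norm_num) hd, hXR] with ω hω h r hr
    simp_rw [h]
    exact (integrable_inv_of_inverseClock_lt_top (hX.continuous ω) hr (hω r)).1
  · intro r hr
    have hr0 : 0 < r := (Real.exp_pos _).trans_le hr
    have key := hX.measure_deviation_le hd hδ'0 hδ'd hr
    have e : Real.exp (-c₄ * Real.log r) = (r ^ c₄)⁻¹ := by
      rw [← Real.rpow_neg hr0.le, Real.rpow_def_of_pos hr0]
      ring_nf
    rw [← hc₄, e, ← div_eq_mul_inv] at key
    refine ENNReal.toReal_le_of_le_ofReal (by positivity) (le_trans (measure_mono_ae ?_) key)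
    filter_upwards [hXR] with ω h hm
    change |_| > δ'
    change |_| > δ at hm
    simp_rw [h] at hm
    exact lt_of_le_of_lt (min_le_left _ _) hm

end BrownianPotential

theorem lemma3p2 :
    (∀ κ : ℝ, 1 < κ → ∀ δ : ℝ, 0 < δ →
      ∃ c₁ c₂ r₀ : ℝ, 0 < c₁ ∧ 0 < c₂ ∧ 0 < r₀ ∧
        ∀ (Ω : Type*) [MeasurableSpace Ω] (P : Measure Ω) [IsProbabilityMeasure P]
          (B : ℝ → Ω → ℝ), BrownianPotential.IsTwoSidedBrownian B P →
          ∀ r : ℝ, r₀ ≤ r →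
            P.real {ω | |Real.log (BrownianPotential.expFunctional κ B r ω) - κ / 2 * r| > δ * r}
              ≤ c₁ * Real.exp (-c₂ * r)) ∧
    (∀ d : ℝ, 2 < d → ∀ δ : ℝ, 0 < δ →
      ∃ c₃ c₄ r₀ : ℝ, 0 < c₃ ∧ 0 < c₄ ∧ 1 < r₀ ∧
        ∀ (Ω : Type*) [MeasurableSpace Ω] (P : Measure Ω) [IsProbabilityMeasure P]
          (R : ℝ≥0 → Ω → ℝ), BrownianPotential.IsBessel d 2 R P →
          (∀ᵐ ω ∂P, ∀ r : ℝ, 0 ≤ r →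
            IntervalIntegrable (fun s : ℝ => 1 / R s.toNNReal ω ^ 2) volume 0 r) ∧
          ∀ r : ℝ, r₀ ≤ r →
            P.real {ω | |1 / Real.log r * (∫ s in (0 : ℝ)..r, 1 / R s.toNNReal ω ^ 2)
                - 1 / (d - 2)| > δ}
              ≤ c₃ / r ^ c₄) := by
  refine ⟨fun κ hκ δ hδ => ?_, fun d hd δ hδ => BrownianPotential.bessel_deviation hd hδ⟩
  exact BrownianPotential.expFunctional_deviation (by linarith) hδ
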